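/- Let $1\le k\le 5$ and $n=2^k-1$. Let $F:\mathbb F_2^k\to\mathbb F_2$ be a linear map and let $\Lambda(x_0,\dots,x_{k-1})=(x_1,\dots,x_{k-1},F(x_0,\dots,x_{k-1}))$ be the corresponding $k$-stage linear feedback shift register. Let $y=y_0y_1y_2\dots$ be an infinite sequence produced by $\Lambda$, that is, $\Lambda^t(y_0,\dots,y_{k-1})=(y_t,\dots,y_{t+k-1})$ for all $t\ge 0$, and suppose that the eventual period of the sequence of states $\Lambda^t(y_0,\dots,y_{k-1})$, $t\ge 0$ (the least $N>0$ such that the terms with indices $t$ and $t+N$ agree for all sufficiently large $t$) equals $2^k-1$; so $x=y_0y_1\dots y_{n-1}\in\{0,1\}^n$ is a binary $m$-sequence. Let $A_N(x)$ be the nondeterministic automatic complexity of $x$: the minimum number of states of a nondeterministic finite automaton (without $\varepsilon$-transitions) that accepts $x$ and has only one accepting path of length $|x|=n$, where a path is a sequence of labelled transitions. Then $$A_N(x)=\lfloor n/2\rfloor+1.$$ -/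

import Mathlib

/-- The `k`-stage combinatorial shift register over the alphabet `α` with feedback function `F`:
`(x₀, …, x_{k-1}) ↦ (x₁, …, x_{k-1}, F (x₀, …, x_{k-1}))`. -/
def shiftRegister {α : Type*} {k : ℕ} (F : (Fin k → α) → α) (v : Fin k → α) : Fin k → α :=
  fun i => if h : (i : ℕ) + 1 < k then v ⟨(i : ℕ) + 1, h⟩ else F v

/-- The map `L` on states produces the infinite sequence `y`: after `t` steps from the state
`(y₀, …, y_{k-1})` the register contains `(y_t, …, y_{t+k-1})`. -/
def Produces {α : Type*} {k : ℕ} (L : (Fin k → α) → (Fin k → α)) (y : ℕ → α) : Prop :=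
  ∀ t : ℕ, L^[t] (fun i : Fin k => y i) = fun i : Fin k => y (t + i)

/-- `P` is the eventual period of the sequence `z`: the least `N > 0` such that
`z (n + N) = z n` for all sufficiently large `n`. -/
def HasEventualPeriod {β : Type*} (z : ℕ → β) (P : ℕ) : Prop :=
  IsLeast {N : ℕ | 0 < N ∧ ∃ M : ℕ, ∀ n : ℕ, M ≤ n → z (n + N) = z n} P

/-- `x` is a (binary) `m`-sequence coming from a `k`-stage linear feedback shift register: some
register with linear feedback function over the two-element field produces `y` with period
`P = 2 ^ k - 1` (the period being that of the sequence of register states), and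
`x = y₀ … y_{P-1}`. -/
def IsMSequence (k : ℕ) (x : List (ZMod 2)) : Prop :=
  ∃ (F : (Fin k → ZMod 2) →ₗ[ZMod 2] ZMod 2) (y : ℕ → ZMod 2),
    Produces (shiftRegister F) y ∧
    HasEventualPeriod (fun t : ℕ => (shiftRegister F)^[t] (fun i : Fin k => y i)) (2 ^ k - 1) ∧
    x = List.ofFn (fun i : Fin (2 ^ k - 1) => y i)

/-- An accepting path of length `n` of the automaton `M`: a path of `n` labelled transitions
from a start state to an accepting state, together with the word that it reads. -/
structure AcceptingPath {α σ : Type*} (M : NFA α σ) (n : ℕ) where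
  source : σ
  target : σ
  word : List α
  path : M.Path source target word
  source_mem : source ∈ M.start
  target_mem : target ∈ M.accept
  length_word : word.length = n

/-- `M` accepts `x`, and `M` has only one accepting path of length `|x|`, over all words of that
length. -/
def UniquelyAccepts {α σ : Type*} (M : NFA α σ) (x : List α) : Prop :=
  x ∈ M.accepts ∧ Subsingleton (AcceptingPath M x.length)

/-- The nondeterministic automatic complexity of `x`: the minimum number of states of a
nondeterministic finite automaton that accepts `x` and has only one accepting path of
length `|x|`. -/
noncomputable def nondetAutomaticComplexity {α : Type*} (x : List α) : ℕ :=
  sInf {q : ℕ | ∃ M : NFA α (Fin q), UniquelyAccepts M x}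

/-!
# The nondeterministic automatic complexity of short `m`-sequences

Let `n = 2 ^ k - 1 = 2 * m + 1`. The upper bound `m + 1` holds for every word of length `n`: fold
the word, reading it along `0, 1, …, m, m, …, 1, 0` (`foldedNFA`). A return to `0` after an odd
number of steps has to use the loop at `m`, and only time `m` is early and late enough for that.

For the lower bound, suppose that an automaton with at most `m` states has a single accepting path
of length `n`, with states `s 0, …, s n`. Every walk of length `n` from `s 0` to `s n` in the graph
traced by `s` is then `s` itself (`UniqueWalk`), so pieces of `s` cannot be rearranged. This has
strong consequences:

* A state visited at least three times lies on a *run*, an interval of time during which a cycle of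
  some length `l` is repeated (`UniqueWalk.exists_run`). As the windows of length `k` of an
  `m`-sequence are distinct, a run exceeds its period by less than `k` steps.
* The other states are visited once (*single* times) or twice (*chords*). Crossing chords are
  parallel (`IsChord.crossing`). A closed walk off a run, repeated until it is as long as some turns
  of the run, could take the place of these turns (`IsRun.no_closed_walk`). Exchanging chords and
  turns restricts the chords that do not enclose the run (`IsChord.not_dvd`,
  `IsChord.not_disjoint`).
* Counting visits bounds the number of single times (`card_single_add_le`); as `n + 1 ≥ 2 * m + 2`,
  some state is visited three times. For `k ≤ 5` there is a single run, of period at most `3`, or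
  there are two, of periods `3` and `4` (`IsRun.three_four`).

What remains is a finite problem: given the word and the runs, to arrange the chords and the single
times. The function `refute` searches through all arrangements from left to right, keeping a stack
of chords that are open, and discards those that violate a consequence above. The few complete
arrangements left are discarded since their graph has a second walk of length `n` (`detour`). The
search is correct for every word (`Search.IsModel.refute_eq_false`), and it is carried out by
evaluation for all words produced by linear registers with `k ≤ 5` whose `2 ^ k - 1` states are
distinct (`testCoeff_eq_true`).
-/

/-! ### Walks in the graph traced by a sequence of states -/

section

/-- One step of the graph traced by `s`: the pair `(p, q)` is traversed by `s` before time `n`. -/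
def TraceStep {σ : Type*} (s : ℕ → σ) (n : ℕ) (p q : σ) : Prop :=
  ∃ t < n, s t = p ∧ s (t + 1) = q

/-- Walks of a given length in the directed graph traced by `s` up to time `n`. -/
def TraceWalk {σ : Type*} (s : ℕ → σ) (n : ℕ) : ℕ → σ → σ → Prop
  | 0, p, q => p = q
  | m + 1, p, q => ∃ r, TraceStep s n p r ∧ TraceWalk s n m r q

/-- `s` is the only walk of length `n` from `s 0` to `s n` in the graph that it traces, and
`x t` is the label of its `t`-th edge, a function of that edge. -/
structure UniqueWalk {σ α : Type*} (s : ℕ → σ) (x : ℕ → α) (n : ℕ) : Prop where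
  eq_of_walk : ∀ {a b r}, a + b = n → TraceWalk s n a (s 0) r → TraceWalk s n b r (s n) → r = s a
  label_eq : ∀ {i j}, i < n → j < n → s i = s j → s (i + 1) = s (j + 1) → x i = x j

namespace TraceWalk

variable {σ : Type*} {s : ℕ → σ} {n : ℕ}

theorem trans {a b c : ℕ} {p q r : σ} (h : TraceWalk s n a p q) (h' : TraceWalk s n b q r)
    (hc : a + b = c) : TraceWalk s n c p r := by
  subst hc
  induction a generalizing p with
  | zero => cases h; simpa using h'
  | succ a ih =>
    obtain ⟨u, hu, hw⟩ := h
    rw [Nat.succ_add]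
    exact ⟨u, hu, ih hw⟩

theorem seg {i j : ℕ} (hij : i ≤ j) (hj : j ≤ n) : TraceWalk s n (j - i) (s i) (s j) := by
  obtain ⟨m, rfl⟩ := Nat.exists_eq_add_of_le hij
  rw [Nat.add_sub_cancel_left]
  clear hij
  induction m generalizing i with
  | zero => rfl
  | succ m ih =>
    refine ⟨s (i + 1), ⟨i, by omega, rfl, rfl⟩, ?_⟩
    have := ih (i := i + 1) (by omega)
    rwa [show i + 1 + m = i + (m + 1) by omega] at this

/-- The segment of `s` from time `i` to time `j`, with the states at its ends and its length
rewritten. -/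
theorem seg' {i j m : ℕ} {p q : σ} (hij : i + m = j) (hj : j ≤ n) (hp : s i = p) (hq : s j = q) :
    TraceWalk s n m p q := by
  subst hp hq
  have := seg (s := s) (n := n) (i := i) (j := j) (by omega) hj
  rwa [show j - i = m by omega] at this

theorem pow {d : ℕ} {p : σ} (h : TraceWalk s n d p p) (m : ℕ) : TraceWalk s n (d * m) p p := by
  induction m with
  | zero => rfl
  | succ m ih => exact ih.trans h (by ring)

end TraceWalk

namespace UniqueWalk

variable {σ α : Type*} {s : ℕ → σ} {x : ℕ → α} {n : ℕ}

/-- Interchanging the segments `[i, i']` and `[j, j']`, when they have the same end states,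
keeps the total length; so the walk is unchanged. -/
theorem swap (U : UniqueWalk s x n) {i i' j j' : ℕ} (h1 : i ≤ i') (h2 : i' ≤ j) (h3 : j ≤ j')
    (hn : j' ≤ n) (hi : s i = s j) (hi' : s i' = s j') :
    (∀ e, j + e ≤ j' → s (i + e) = s (j + e)) ∧
      ∀ f, i' + f ≤ j → s (i + (j' - j) + f) = s (i' + f) := by
  constructor
  · intro e he
    symm
    refine U.eq_of_walk (b := (j' - j - e) + ((j - i') + ((i' - i) + (n - j')))) (by omega)
      ((TraceWalk.seg' (i := 0) (j := i) (m := i) (by omega) (by omega) rfl hi).trans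
        (TraceWalk.seg' (i := j) (j := j + e) (m := e) rfl (by omega) rfl rfl) rfl) ?_
    exact (TraceWalk.seg' (i := j + e) (j := j') (by omega) hn rfl hi'.symm).trans
      ((TraceWalk.seg' (i := i') (j := j) (by omega) (by omega) rfl hi.symm).trans
      ((TraceWalk.seg' (i := i) (j := i') (by omega) (by omega) rfl hi').trans
      (TraceWalk.seg' (i := j') (j := n) (by omega) (by omega) rfl rfl) rfl) rfl) rfl
  · intro f hf
    symm
    refine U.eq_of_walk (b := (j - i' - f) + ((i' - i) + (n - j'))) (by omega)
      (((TraceWalk.seg' (i := 0) (j := i) (m := i) (by omega) (by omega) rfl hi).trans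
        (TraceWalk.seg' (i := j) (j := j') (m := j' - j) (by omega) (by omega) rfl hi'.symm)
        rfl).trans
        (TraceWalk.seg' (i := i') (j := i' + f) (m := f) rfl (by omega) rfl rfl) rfl) ?_
    exact (TraceWalk.seg' (i := i' + f) (j := j) (by omega) (by omega) rfl hi.symm).trans
      ((TraceWalk.seg' (i := i) (j := i') (by omega) (by omega) rfl hi').trans
      (TraceWalk.seg' (i := j') (j := n) (by omega) (by omega) rfl rfl) rfl) rfl

/-- Three consecutive visits of a state are equally spaced, and the two loops between them are
the same. -/
theorem equally_spaced (U : UniqueWalk s x n) {a b c : ℕ} (hab : a < b) (hbc : b < c) (hc : c ≤ n)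
    (h1 : s a = s b) (h2 : s b = s c) (hab' : ∀ u, a < u → u < b → s u ≠ s b)
    (hbc' : ∀ u, b < u → u < c → s u ≠ s b) :
    b - a = c - b ∧ ∀ e, b + e ≤ c → s (a + e) = s (b + e) := by
  obtain ⟨hA, hB⟩ := U.swap hab.le le_rfl hbc.le hc h1 h2
  refine ⟨?_, hA⟩
  rcases lt_trichotomy (b - a) (c - b) with h | h | h
  · have := hA (b - a) (by omega)
    rw [show a + (b - a) = b by omega] at this
    exact absurd this.symm (hbc' _ (by omega) (by omega))
  · exact h
  · have := hB 0 (by omega)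
    exact absurd this (hab' _ (by omega) (by omega))

/-- The visits of a state that is visited at least three times form an arithmetic progression,
along which the walk is periodic. -/
theorem visits_of_three (U : UniqueWalk s x n) {a b c : ℕ} (hab : a < b) (hbc : b < c) (hc : c ≤ n)
    (h1 : s a = s b) (h2 : s b = s c) :
    ∃ f e l, 0 < l ∧ f + 2 * l ≤ e ∧ e ≤ n ∧
      (∀ u ≤ n, s u = s a ↔ f ≤ u ∧ u ≤ e ∧ u ≡ f [MOD l]) ∧
      ∀ t, f ≤ t → t + l ≤ e → s (t + l) = s t := by
  classical
  set p := s a with hp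
  have ha : s a = p := rfl
  have hb : s b = p := h1.symm
  have hcc : s c = p := by rw [← h2, hb]
  -- the next visit after a time, and the last visit before it
  have nxt : ∀ t w, t < w → w ≤ n → s w = p →
      ∃ v, t < v ∧ v ≤ w ∧ s v = p ∧ ∀ u, t < u → u < v → s u ≠ p := by
    intro t w htw hw hs
    have hex : ∃ v, t < v ∧ s v = p := ⟨w, htw, hs⟩
    refine ⟨Nat.find hex, (Nat.find_spec hex).1, Nat.find_min' hex ⟨htw, hs⟩,
      (Nat.find_spec hex).2, fun u hu hv hh => Nat.find_min hex hv ⟨hu, hh⟩⟩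
  have prv : ∀ t w, w < t → s w = p → ∃ v, w ≤ v ∧ v < t ∧ s v = p ∧
      ∀ u, v < u → u < t → s u ≠ p := by
    intro t w hwt hs
    have hP : ∃ d, s (t - 1 - d) = p := ⟨t - 1 - w, by rwa [show t - 1 - (t - 1 - w) = w by omega]⟩
    refine ⟨t - 1 - Nat.find hP, ?_, by omega, Nat.find_spec hP, ?_⟩
    · have := Nat.find_min' hP (m := t - 1 - w) (by rwa [show t - 1 - (t - 1 - w) = w by omega])
      omega
    · intro u hu hut hh
      have := Nat.find_min' hP (m := t - 1 - u) (by rwa [show t - 1 - (t - 1 - u) = u by omega])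
      omega
  have hex : ∃ v, s v = p := ⟨a, rfl⟩
  set f := Nat.find hex with hf
  have hfp : s f = p := Nat.find_spec hex
  have hfmin : ∀ u, s u = p → f ≤ u := fun u hu => Nat.find_min' hex hu
  have hfa : f ≤ a := hfmin a rfl
  obtain ⟨g, hfg, hgb, hgp, hfg'⟩ := nxt f b (by omega) (by omega) hb
  obtain ⟨l, hl⟩ : ∃ l, g = f + l := ⟨g - f, by omega⟩
  have hl0 : 0 < l := by omega
  set e := Nat.findGreatest (fun v => s v = p) n with he
  have hep : s e = p := Nat.findGreatest_spec (P := fun v => s v = p) (m := a) (by omega) rfl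
  have hen : e ≤ n := Nat.findGreatest_le n
  have hemax : ∀ u ≤ n, s u = p → u ≤ e := fun u hu hs => Nat.le_findGreatest hu hs
  have hce : c ≤ e := hemax c hc hcc
  -- every visit before the last one is followed by a visit after exactly `l` steps
  have step : ∀ t, s t = p → t < e →
      t + l ≤ e ∧ s (t + l) = p ∧ ∀ u, t < u → u < t + l → s u ≠ p := by
    intro t
    induction t using Nat.strong_induction_on with
    | _ t ih =>
      intro ht hte
      rcases eq_or_lt_of_le (hfmin t ht) with h | h
      · subst h
        refine ⟨?_, by rw [← hl]; exact hgp, by rw [← hl]; exact hfg'⟩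
        have := hemax g (by omega) hgp
        omega
      · obtain ⟨v, hv1, hv2, hv3, hv4⟩ := prv t f h hfp
        obtain ⟨w, hw1, hw2, hw3, hw4⟩ := nxt t e hte hen hep
        obtain ⟨i1, i2, i3⟩ := ih v hv2 hv3 (by omega)
        have : v + l = t := by
          rcases lt_trichotomy (v + l) t with h' | h' | h'
          · exact absurd i2 (hv4 _ (by omega) h')
          · exact h'
          · exact absurd ht (i3 t hv2 h')
        have heq := U.equally_spaced hv2 hw1 (by omega) (by rw [hv3, ht]) (by rw [ht, hw3])
          (by rw [ht]; exact hv4) (by rw [ht]; exact hw4)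
        have : w = t + l := by omega
        subst this
        exact ⟨hw2, hw3, hw4⟩
  have mult : ∀ m, f + m * l ≤ e → s (f + m * l) = p := by
    intro m
    induction m with
    | zero => intro; simpa using hfp
    | succ m ih =>
      intro hm
      have h1 : f + (m + 1) * l = f + m * l + l := by ring
      rw [h1] at hm ⊢
      exact (step _ (ih (by omega)) (by omega)).2.1
  have conv : ∀ u, u ≤ n → s u = p → ∃ m, u = f + m * l := by
    intro u
    induction u using Nat.strong_induction_on with
    | _ u ih =>
      intro hu hs
      rcases eq_or_lt_of_le (hfmin u hs) with h | h
      · exact ⟨0, by omega⟩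
      · obtain ⟨v, hv1, hv2, hv3, hv4⟩ := prv u f h hfp
        obtain ⟨m, hm⟩ := ih v hv2 (by omega) hv3
        have hue := hemax u hu hs
        obtain ⟨i1, i2, i3⟩ := step v hv3 (by omega)
        refine ⟨m + 1, ?_⟩
        have : v + l = u := by
          rcases lt_trichotomy (v + l) u with h' | h' | h'
          · exact absurd i2 (hv4 _ (by omega) h')
          · exact h'
          · exact absurd hs (i3 u hv2 h')
        rw [add_mul, one_mul]; omega
  obtain ⟨ma, hma⟩ := conv a (by omega) rfl
  obtain ⟨mb, hmb⟩ := conv b (by omega) hb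
  obtain ⟨mc, hmc⟩ := conv c hc hcc
  obtain ⟨me, hme⟩ := conv e hen hep
  have hmc2 : 2 ≤ mc := by
    by_contra hlt
    have h1 : ma < mb := by
      by_contra hh
      have := Nat.mul_le_mul_right l (not_lt.1 hh); omega
    have h2 : mb < mc := by
      by_contra hh
      have := Nat.mul_le_mul_right l (not_lt.1 hh); omega
    omega
  refine ⟨f, e, l, hl0, ?_, hen, ?_, ?_⟩
  · have := Nat.mul_le_mul_right l hmc2; omega
  · intro u hu
    constructor
    · intro hs
      refine ⟨hfmin u hs, hemax u hu hs, ?_⟩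
      obtain ⟨m, rfl⟩ := conv u hu hs
      simp [Nat.ModEq]
    · rintro ⟨h1, h2, h3⟩
      obtain ⟨m, hm⟩ := (Nat.modEq_iff_dvd' h1).1 h3.symm
      have : u = f + m * l := by rw [mul_comm]; omega
      rw [this]
      exact mult m (by omega)
  · intro t hft hte
    obtain ⟨m, r, hr, htm⟩ : ∃ m r, r < l ∧ t = f + m * l + r :=
      ⟨(t - f) / l, (t - f) % l, Nat.mod_lt _ hl0, by have := Nat.div_add_mod' (t - f) l; omega⟩
    have hv := mult m (by omega)
    obtain ⟨i1, i2, i3⟩ := step _ hv (by omega)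
    rcases eq_or_lt_of_le i1 with h | h
    · have : r = 0 := by omega
      subst this
      rw [htm, add_zero, i2, hv]
    · obtain ⟨j1, j2, j3⟩ := step _ i2 h
      have := (U.equally_spaced (a := f + m * l) (b := f + m * l + l) (c := f + m * l + l + l)
        (by omega) (by omega) (by omega) (by rw [hv, i2]) (by rw [i2, j2])
        (by rw [i2]; exact i3) (by rw [i2]; exact j3)).2 r (by omega)
      rw [htm, this]; congr 1; omega

end UniqueWalk

end

/-! ### Runs -/

section

/-- A run of a walk: a time interval `[a, a + L]` during which a cycle of length `l` is repeated. -/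
structure Run where
  a : ℕ
  l : ℕ
  L : ℕ

/-- The number of full turns of the cycle in a run. -/
def Run.turns (r : Run) : ℕ := r.L / r.l

/-- The time `t` belongs to the run `r`. -/
def Run.Mem (r : Run) (t : ℕ) : Prop := r.a ≤ t ∧ t ≤ r.a + r.L

/-- `r` is a run of the walk `s` of length `n`: the states met during `r` are those of a simple
cycle of length `r.l`, traversed at least twice, and they are met at no other time. -/
structure IsRun {σ : Type*} (s : ℕ → σ) (n : ℕ) (r : Run) : Prop where
  le : r.a + r.L ≤ n
  pos : 0 < r.l
  two : 2 * r.l ≤ r.L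
  iff : ∀ {t u}, r.Mem t → u ≤ n → (s u = s t ↔ r.Mem u ∧ u ≡ t [MOD r.l])

variable {σ α : Type*} {s : ℕ → σ} {x : ℕ → α} {n : ℕ}

theorem periodic_of_modEq {A E l : ℕ} (per : ∀ t, A ≤ t → t + l ≤ E → s (t + l) = s t) {t u : ℕ}
    (ht : A ≤ t) (htu : t ≤ u) (hu : u ≤ E) (h : u ≡ t [MOD l]) : s u = s t := by
  obtain ⟨m, hm⟩ := (Nat.modEq_iff_dvd' htu).1 h.symm
  obtain rfl : u = t + m * l := by rw [mul_comm]; omega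
  clear hm h htu
  induction m with
  | zero => simp
  | succ m ih =>
    have h1 : t + (m + 1) * l = t + m * l + l := by ring
    rw [h1] at hu ⊢
    rw [per _ (by omega) hu, ih (by omega)]

/-- A state that is visited at least three times lies on a run. -/
theorem UniqueWalk.exists_run (U : UniqueWalk s x n) {a b c : ℕ} (hab : a < b) (hbc : b < c)
    (hc : c ≤ n) (h1 : s a = s b) (h2 : s b = s c) : ∃ r, IsRun s n r ∧ r.Mem a := by
  classical
  obtain ⟨f, e, l, hl, hfe, hen, hvis, hper⟩ := U.visits_of_three hab hbc hc h1 h2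
  have hA : ∃ A, A ≤ f ∧ ∀ t, A ≤ t → t + l ≤ e → s (t + l) = s t := ⟨f, le_rfl, hper⟩
  set A := Nat.find hA with hAdef
  obtain ⟨hAf, hAper⟩ := Nat.find_spec hA
  rw [← hAdef] at hAf hAper
  set P : ℕ → Prop := fun E => ∀ t, f ≤ t → t + l ≤ E → s (t + l) = s t with hP
  set E := Nat.findGreatest P n with hEdef
  have hEe : e ≤ E := Nat.le_findGreatest hen hper
  have hEn : E ≤ n := Nat.findGreatest_le n
  have hEper : P E := Nat.findGreatest_spec (m := e) hen hper
  have per : ∀ t, A ≤ t → t + l ≤ E → s (t + l) = s t := by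
    intro t ht htE
    rcases le_or_gt f t with h | h
    · exact hEper t h htE
    · exact hAper t ht (by omega)
  have hfp : s f = s a := (hvis f (by omega)).2 ⟨le_rfl, by omega, rfl⟩
  -- the maximal interval of period `l` contains all visits of its states
  have key : ∀ t u, A ≤ t → t ≤ E → u ≤ n → s u = s t → (A ≤ u ∧ u ≤ E) ∧ u ≡ t [MOD l] := by
    intro t u ht htE hu hut
    obtain ⟨t1, ht1A, ht1l, ht1t, ht1⟩ : ∃ t1, A ≤ t1 ∧ t1 < A + l ∧ t1 ≤ t ∧ t ≡ t1 [MOD l] := by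
      refine ⟨A + (t - A) % l, by omega, by have := Nat.mod_lt (t - A) hl; omega,
        by have := Nat.mod_le (t - A) l; omega, ?_⟩
      have : t = A + (t - A) := by omega
      conv_lhs => rw [this]
      exact Nat.ModEq.add_left _ (Nat.mod_modEq _ _).symm
    have hs1 : s t = s t1 := periodic_of_modEq per ht1A ht1t htE ht1
    have hs2 : s (t1 + l) = s t1 := per t1 ht1A (by omega)
    by_cases hu1 : u = t1
    · exact ⟨by omega, hu1 ▸ ht1.symm⟩
    by_cases hu2 : u = t1 + l
    · refine ⟨by omega, ?_⟩
      rw [hu2]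
      exact (by simp [Nat.ModEq] : t1 + l ≡ t1 [MOD l]).trans ht1.symm
    have hsu : s u = s t1 := hut.trans hs1
    obtain ⟨f', e', l', hl', hfe', hen', hvis', hper'⟩ : ∃ f e l', 0 < l' ∧ f + 2 * l' ≤ e ∧
        e ≤ n ∧ (∀ u ≤ n, s u = s t1 ↔ f ≤ u ∧ u ≤ e ∧ u ≡ f [MOD l']) ∧
        ∀ t, f ≤ t → t + l' ≤ e → s (t + l') = s t := by
      rcases lt_trichotomy u t1 with h | h | h
      · have := U.visits_of_three h (show t1 < t1 + l by omega) (by omega) hsu hs2.symm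
        simpa only [hsu] using this
      · exact absurd h hu1
      · rcases lt_trichotomy u (t1 + l) with h' | h' | h'
        · exact U.visits_of_three h h' (by omega) hsu.symm (by rw [hsu, hs2])
        · exact absurd h' hu2
        · exact U.visits_of_three (show t1 < t1 + l by omega) h' (by omega) hs2.symm
            (by rw [hs2, hsu])
    obtain ⟨p1, p2, p3⟩ := (hvis' t1 (by omega)).1 rfl
    obtain ⟨q1, q2, q3⟩ := (hvis' (t1 + l) (by omega)).1 hs2
    obtain ⟨u1, u2, u3⟩ := (hvis' u hu).1 hsu
    have hdvd : l' ∣ l := by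
      have := (Nat.modEq_iff_dvd' (Nat.le_add_right t1 l)).1 (p3.trans q3.symm)
      simpa using this
    -- the period of `s u` is not smaller, since every window of length `l` meets `s a` just once
    have hll : l' = l := by
      by_contra hne
      have hlt : 2 * l' ≤ l := by
        obtain ⟨m, rfl⟩ := hdvd
        rcases m with _ | _ | m
        · omega
        · omega
        · have : 2 ≤ m + 2 := by omega
          have := Nat.mul_le_mul_left l' this
          linarith
      obtain ⟨t0, ht01, ht02, ht0⟩ : ∃ t0, t1 ≤ t0 ∧ t0 < t1 + l ∧ t0 ≡ f [MOD l] := by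
        refine ⟨t1 + (f + t1 * (l - 1)) % l, by omega,
          by have := Nat.mod_lt (f + t1 * (l - 1)) hl; omega, ?_⟩
        have h3 : t1 + (f + t1 * (l - 1)) % l ≡ t1 + (f + t1 * (l - 1)) [MOD l] :=
          Nat.ModEq.add_left _ (Nat.mod_modEq _ _)
        refine h3.trans ?_
        have h4 : t1 + (f + t1 * (l - 1)) = f + l * t1 := by
          obtain ⟨l0, rfl⟩ : ∃ l0, l = l0 + 1 := ⟨l - 1, by omega⟩
          simp; ring
        rw [h4]; simp [Nat.ModEq]
      have hs0 : s t0 = s a := by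
        rw [← hfp]
        rcases le_total f t0 with h | h
        · exact periodic_of_modEq per hAf h (by omega) ht0
        · exact (periodic_of_modEq per (by omega) h (by omega) ht0.symm).symm
      have aux : ∀ v, v ≤ n → s v = s a → (v = t0 + l' ∨ v + l' = t0) → False := by
        intro v hv hsv hvt
        have h5 := ((hvis v hv).1 hsv).2.2.trans ht0.symm
        have h6 : l ∣ l' := by
          rcases hvt with rfl | rfl
          · have := (Nat.modEq_iff_dvd' (Nat.le_add_right t0 l')).1 h5.symm
            simpa using this
          · have := (Nat.modEq_iff_dvd' (Nat.le_add_right v l')).1 h5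
            simpa using this
        have := Nat.le_of_dvd hl' h6
        omega
      rcases le_or_gt (t0 + l') (t1 + l) with h | h
      · exact aux (t0 + l') (by omega) (by rw [hper' t0 (by omega) (by omega), hs0]) (Or.inl rfl)
      · refine aux (t0 - l') (by omega) ?_ (Or.inr (by omega))
        have := hper' (t0 - l') (by omega) (by omega)
        rw [← this, show t0 - l' + l' = t0 by omega, hs0]
    subst hll
    refine ⟨⟨?_, ?_⟩, (u3.trans p3.symm).trans ht1.symm⟩
    · by_contra hlt
      have : A ≤ A - 1 := by
        refine Nat.find_min' hA ⟨by omega, fun t ht hte => ?_⟩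
        rcases eq_or_lt_of_le ht with h | h
        · exact hper' t (by omega) (by omega)
        · exact hAper t (by omega) hte
      omega
    · by_contra hlt
      have : E + 1 ≤ E := by
        refine Nat.le_findGreatest (by omega) fun t ht hte => ?_
        rcases eq_or_lt_of_le hte with h | h
        · exact hper' t (by omega) (by omega)
        · exact hEper t ht (by omega)
      omega
  have hin := (hvis a (by omega)).1 rfl
  refine ⟨⟨A, l, E - A⟩, ⟨by simp only; omega, hl, by simp only; omega, ?_⟩,
    by simp only [Run.Mem]; omega⟩
  intro t u ht hu
  simp only [Run.Mem, show A + (E - A) = E by omega] at ht ⊢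
  refine ⟨fun h => key t u ht.1 ht.2 hu h, ?_⟩
  rintro ⟨⟨h3, h4⟩, h5⟩
  rcases le_total t u with h | h
  · exact periodic_of_modEq per ht.1 h h4 h5
  · exact (periodic_of_modEq per h3 h ht.2 h5.symm).symm

end

/-! ### Closed walks and turns of a run -/

section

variable {σ α : Type*} {s : ℕ → σ} {x : ℕ → α} {n : ℕ}

/-- Whether some multiple of `d` is the length of at least one and at most `m` turns of a cycle of
length `l`; only the multiples `d` and `l * d` are tested. -/
def badLen (l m d : ℕ) : Bool := Nat.ble d m || (Nat.beq (d % l) 0 && Nat.ble d (m * l))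

theorem exists_of_badLen {l m d : ℕ} (hd : 0 < d) (hl : 0 < l)
    (h : badLen l m d = true) : ∃ γ δ, d * γ = l * δ ∧ 1 ≤ δ ∧ δ ≤ m := by
  simp only [badLen, Bool.or_eq_true, Bool.and_eq_true, Nat.ble_eq, Nat.beq_eq] at h
  rcases h with h | ⟨h1, h2⟩
  · exact ⟨l, d, mul_comm _ _, hd, h⟩
  · obtain ⟨δ, rfl⟩ := Nat.dvd_of_mod_eq_zero h1
    refine ⟨1, δ, by simp, Nat.pos_of_mul_pos_left hd, ?_⟩
    rw [mul_comm m] at h2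
    exact Nat.le_of_mul_le_mul_left h2 hl

namespace IsRun

variable {r : Run}

theorem turns_mul_le (_hr : IsRun s n r) : r.turns * r.l ≤ r.L := Nat.div_mul_le_self _ _

theorem two_le_turns (hr : IsRun s n r) : 2 ≤ r.turns :=
  (Nat.le_div_iff_mul_le hr.pos).2 hr.two

theorem lt_turns_succ_mul (hr : IsRun s n r) : r.L < r.turns * r.l + r.l := by
  have := Nat.div_add_mod' r.L r.l
  have := Nat.mod_lt r.L hr.pos
  simp only [Run.turns]; omega

theorem ne (hr : IsRun s n r) {t u : ℕ} (ht : r.Mem t) (hu : u ≤ n) (hu' : ¬ r.Mem u) :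
    s u ≠ s t := fun h => hu' ((hr.iff ht hu).1 h).1

theorem mem_start (_hr : IsRun s n r) : r.Mem r.a := ⟨le_rfl, by omega⟩

theorem state_turn (hr : IsRun s n r) {δ : ℕ} (hδ : δ ≤ r.turns) : s (r.a + r.l * δ) = s r.a := by
  have h1 : r.l * δ ≤ r.L := by
    have := Nat.mul_le_mul_left r.l hδ
    have := hr.turns_mul_le
    rw [mul_comm] at this
    omega
  refine (hr.iff hr.mem_start (by have := hr.le; omega)).2 ⟨⟨by omega, by omega⟩, ?_⟩
  simp [Nat.ModEq]

theorem walk_turns (hr : IsRun s n r) (c : ℕ) : TraceWalk s n (r.l * c) (s r.a) (s r.a) := by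
  refine TraceWalk.pow ?_ c
  have h := hr.state_turn (δ := 1) (by have := hr.two_le_turns; omega)
  have h1 := hr.le
  have h2 := hr.two
  exact TraceWalk.seg' (i := r.a) (j := r.a + r.l * 1) (by omega) (by omega) rfl h

/-- A closed walk at a state off the run can take the place of turns of the run. -/
theorem no_closed_walk (hr : IsRun s n r) (U : UniqueWalk s x n) {t d γ δ : ℕ} (ht : t ≤ n)
    (htr : ¬ r.Mem t) (w : TraceWalk s n d (s t) (s t)) (h : d * γ = r.l * δ) (h1 : 1 ≤ δ)
    (h2 : δ ≤ r.turns) : False := by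
  have hle := hr.le
  have hs := hr.state_turn h2
  have hpos : 0 < r.l * δ := Nat.mul_pos hr.pos h1
  have hL : r.l * δ ≤ r.L := by
    have := Nat.mul_le_mul_left r.l h2
    have := hr.turns_mul_le
    rw [mul_comm] at this
    omega
  have w' := w.pow γ
  rw [h] at w'
  rcases lt_or_ge t r.a with hlt | hge
  · refine hr.ne (t := r.a - 1 + r.l * δ) (u := r.a - 1) ⟨by omega, by omega⟩ (by omega)
      (fun h => by have := h.1; omega) ?_
    refine U.eq_of_walk (b := 1 + (n - (r.a + r.l * δ))) (by omega)
      (((TraceWalk.seg' (i := 0) (j := t) (m := t) (by omega) ht rfl rfl).trans w' rfl).trans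
        (TraceWalk.seg' (i := t) (j := r.a - 1) (m := r.a - 1 - t) (by omega) (by omega) rfl rfl)
        (by omega)) ?_
    exact (TraceWalk.seg' (i := r.a - 1) (j := r.a) (by omega) (by omega) rfl hs.symm).trans
      (TraceWalk.seg' (i := r.a + r.l * δ) (j := n) (by omega) le_rfl rfl rfl) rfl
  · have hgt : r.a + r.L < t := by
      by_contra hh
      exact htr ⟨hge, by omega⟩
    refine hr.ne (t := r.a + r.L + 1 - r.l * δ) (u := r.a + r.L + 1) ⟨by omega, by omega⟩ (by omega)
      (fun h => by have := h.2; omega) ?_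
    refine U.eq_of_walk (b := (t - (r.a + r.L + 1)) + (r.l * δ + (n - t))) (by omega)
      ((TraceWalk.seg' (i := 0) (j := r.a) (m := r.a) (by omega) (by omega) rfl hs.symm).trans
        (TraceWalk.seg' (i := r.a + r.l * δ) (j := r.a + r.L + 1) (m := r.L + 1 - r.l * δ)
          (by omega) (by omega) rfl rfl) (by omega)) ?_
    exact (TraceWalk.seg' (i := r.a + r.L + 1) (j := t) (by omega) (by omega) rfl rfl).trans
      (w'.trans (TraceWalk.seg' (i := t) (j := n) (by omega) le_rfl rfl rfl) rfl) rfl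

theorem not_badLen (hr : IsRun s n r) (U : UniqueWalk s x n) {t d : ℕ} (ht : t ≤ n)
    (htr : ¬ r.Mem t) (w : TraceWalk s n d (s t) (s t)) (hd : 0 < d) :
    badLen r.l r.turns d = false := by
  by_contra h
  obtain ⟨γ, δ, h1, h2, h3⟩ := exists_of_badLen hd hr.pos (by simpa using h)
  exact hr.no_closed_walk U ht htr w h1 h2 h3

end IsRun

/-- The walk `s` visits the state `s i = s j` for the first time at time `i` and for the last time
at time `j`. -/
structure IsExcursion (s : ℕ → σ) (n i j : ℕ) : Prop where
  le : i ≤ j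
  le_n : j ≤ n
  eq : s i = s j
  first : ∀ u < i, s u ≠ s i
  last : ∀ u ≤ n, j < u → s u ≠ s j

namespace UniqueWalk

theorem excursion_le (U : UniqueWalk s x n) {i j e ρ : ℕ} (h : IsExcursion s n i j)
    (w : TraceWalk s n e (s i) (s i)) (w' : TraceWalk s n ρ (s j) (s n)) (hn : i + e + ρ = n) :
    i + e ≤ j := by
  by_contra hlt
  refine h.last (i + e) (by omega) (by omega) ?_
  rw [← h.eq] at w' ⊢
  have h1 := h.le
  have h2 := h.le_n
  exact (U.eq_of_walk hn ((TraceWalk.seg' (i := 0) (j := i) (m := i) (by omega) (by omega)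
    rfl rfl).trans w rfl) w').symm

theorem excursion_ge (U : UniqueWalk s x n) {i j e i' ρ : ℕ} (h : IsExcursion s n i j)
    (w : TraceWalk s n e (s i) (s i)) (hi' : j ≤ i') (hi'n : i' ≤ n) (h' : ∀ u < i', s u ≠ s i')
    (w' : TraceWalk s n ρ (s i') (s n)) (hn : i + e + (i' - j) + ρ = n) : j ≤ i + e := by
  by_contra hlt
  refine h' (i + e + (i' - j)) (by omega) ?_
  have h1 := h.le
  exact (U.eq_of_walk hn (((TraceWalk.seg' (i := 0) (j := i) (m := i) (by omega) (by omega)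
    rfl rfl).trans w rfl).trans
    (TraceWalk.seg' (i := j) (j := i') (by omega) hi'n h.eq.symm rfl) rfl) w').symm

/-- Replacing two disjoint excursions by closed walks with the same total length does not change
their lengths. -/
theorem exchange_two (U : UniqueWalk s x n) {i₁ j₁ i₂ j₂ e₁ e₂ : ℕ} (h₁ : IsExcursion s n i₁ j₁)
    (h₂ : IsExcursion s n i₂ j₂) (h : j₁ ≤ i₂) (w₁ : TraceWalk s n e₁ (s i₁) (s i₁))
    (w₂ : TraceWalk s n e₂ (s i₂) (s i₂)) (he : e₁ + e₂ + i₁ + i₂ = j₁ + j₂) :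
    i₁ + e₁ = j₁ ∧ i₂ + e₂ = j₂ := by
  have a1 := h₁.le
  have a2 := h₂.le
  have a3 := h₂.le_n
  have w₃ : TraceWalk s n (e₂ + (n - j₂)) (s i₂) (s n) :=
    w₂.trans (TraceWalk.seg' (i := j₂) (j := n) (by omega) le_rfl h₂.eq.symm rfl) rfl
  have b1 := U.excursion_ge h₁ w₁ h (by omega) h₂.first w₃ (by omega)
  have w₄ : TraceWalk s n ((i₂ - j₁) + (e₂ + (n - j₂))) (s j₁) (s n) :=
    (TraceWalk.seg' (i := j₁) (j := i₂) (by omega) (by omega) rfl rfl).trans w₃ rfl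
  have b2 := U.excursion_le h₁ w₁ w₄ (by omega)
  omega

/-- Replacing three disjoint excursions by closed walks with the same total length does not change
their lengths. -/
theorem exchange_three (U : UniqueWalk s x n) {i₁ j₁ i₂ j₂ i₃ j₃ e₁ e₂ e₃ : ℕ}
    (h₁ : IsExcursion s n i₁ j₁) (h₂ : IsExcursion s n i₂ j₂) (h₃ : IsExcursion s n i₃ j₃)
    (h₁₂ : j₁ ≤ i₂) (h₂₃ : j₂ ≤ i₃) (w₁ : TraceWalk s n e₁ (s i₁) (s i₁))
    (w₂ : TraceWalk s n e₂ (s i₂) (s i₂)) (w₃ : TraceWalk s n e₃ (s i₃) (s i₃))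
    (he : e₁ + e₂ + e₃ + i₁ + i₂ + i₃ = j₁ + j₂ + j₃) :
    i₁ + e₁ = j₁ ∧ i₂ + e₂ = j₂ ∧ i₃ + e₃ = j₃ := by
  have a1 := h₁.le
  have a2 := h₂.le
  have a3 := h₃.le
  have a4 := h₃.le_n
  have w₄ : TraceWalk s n (e₂ + (i₃ - j₂) + (e₃ + (n - j₃))) (s i₂) (s n) :=
    (w₂.trans (TraceWalk.seg' (i := j₂) (j := i₃) (by omega) (by omega) h₂.eq.symm rfl) rfl).trans
      (w₃.trans (TraceWalk.seg' (i := j₃) (j := n) (by omega) le_rfl h₃.eq.symm rfl) rfl) rfl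
  have b1 := U.excursion_ge h₁ w₁ h₁₂ (by omega) h₂.first w₄ (by omega)
  have b2 := U.excursion_le h₁ w₁ ((TraceWalk.seg' (i := j₁) (j := i₂) (m := i₂ - j₁)
    (by omega) (by omega) rfl rfl).trans w₄ rfl) (by omega)
  have := U.exchange_two h₂ h₃ h₂₃ w₂ w₃ (by omega)
  omega

end UniqueWalk

/-- The walk `s` visits the state `s i = s j` at the times `i < j` and at no other time. -/
structure IsChord (s : ℕ → σ) (n i j : ℕ) : Prop where
  lt : i < j
  le : j ≤ n
  eq : s i = s j
  only : ∀ u ≤ n, s u = s i → u = i ∨ u = j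

namespace IsChord

variable {i j i' j' : ℕ} {r : Run}

theorem excursion (h : IsChord s n i j) : IsExcursion s n i j where
  le := h.lt.le
  le_n := h.le
  eq := h.eq
  first u hu hs := by
    have := h.only u (by have := h.lt; have := h.le; omega) hs
    have := h.lt
    omega
  last u hu hj hs := by
    have := h.only u hu (hs.trans h.eq.symm)
    have := h.lt
    omega

theorem walk (h : IsChord s n i j) (m : ℕ) : TraceWalk s n ((j - i) * m) (s i) (s i) :=
  (TraceWalk.seg' (by have := h.lt; omega) h.le rfl h.eq.symm).pow m

theorem not_mem_right (h : IsChord s n i j) (hr : IsRun s n r) (hi : ¬ r.Mem i) : ¬ r.Mem j :=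
  fun hj => hr.ne hj (by have := h.lt; have := h.le; omega) hi h.eq

/-- Crossing chords are parallel, with the same states in between. -/
theorem crossing (h : IsChord s n i j) (h' : IsChord s n i' j') (U : UniqueWalk s x n) (h1 : i < i')
    (h2 : i' < j) (h3 : j < j') : j' + i = j + i' ∧ ∀ e, i + e ≤ i' → s (i + e) = s (j + e) := by
  have hle := h'.le
  obtain ⟨hA, hB⟩ := U.swap h1.le h2.le h3.le hle h.eq h'.eq
  have key : j' - j = i' - i := by
    rcases lt_trichotomy (j' - j) (i' - i) with hlt | heq | hgt
    · have := hA (j' - j) (by omega)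
      rw [show j + (j' - j) = j' by omega, ← h'.eq] at this
      have := h'.only _ (by omega) this
      omega
    · exact heq
    · have := hA (i' - i) (by omega)
      rw [show i + (i' - i) = i' by omega] at this
      have := h'.only _ (by omega) this.symm
      omega
  exact ⟨by omega, fun e he => hA e (by omega)⟩

theorem lt_or_lt (h : IsChord s n i j) (hr : IsRun s n r) (hi : ¬ r.Mem i)
    (hne : ¬ (i < r.a ∧ r.a < j)) : j < r.a ∨ r.a + r.L < i := by
  have hj := h.not_mem_right hr hi
  simp only [Run.Mem] at hi hj
  omega

theorem _root_.IsRun.excursion (hr : IsRun s n r) :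
    IsExcursion s n r.a (r.a + r.l * r.turns) where
  le := by omega
  le_n := by
    have := hr.le
    have := hr.turns_mul_le
    rw [mul_comm] at this
    omega
  eq := (hr.state_turn le_rfl).symm
  first u hu hs := by
    have := ((hr.iff hr.mem_start (by have := hr.le; omega)).1 hs).1.1
    omega
  last u hu hj hs := by
    rw [hr.state_turn le_rfl] at hs
    obtain ⟨⟨h1, h2⟩, h3⟩ := (hr.iff hr.mem_start hu).1 hs
    obtain ⟨m, hm⟩ := (Nat.modEq_iff_dvd' h1).1 h3.symm
    have h4 : r.l * r.turns < r.l * m := by omega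
    have h5 : r.turns + 1 ≤ m := Nat.lt_of_mul_lt_mul_left h4
    have := Nat.mul_le_mul_left r.l h5
    have := hr.lt_turns_succ_mul
    rw [mul_add, mul_one, mul_comm r.l r.turns] at *
    omega

/-- A chord that does not enclose a run cannot be traded for turns of the run. -/
theorem not_dvd (h : IsChord s n i j) (hr : IsRun s n r) (U : UniqueWalk s x n) (hi : ¬ r.Mem i)
    (hne : ¬ (i < r.a ∧ r.a < j)) : ¬ r.l ∣ j - i := by
  rintro ⟨c, hc⟩
  have hlt := h.lt
  have hw := hr.walk_turns (r.turns + c)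
  rw [mul_add] at hw
  have hL := hr.turns_mul_le
  rw [mul_comm] at hL
  rcases h.lt_or_lt hr hi hne with h1 | h1
  · have := U.exchange_two h.excursion hr.excursion h1.le (h.walk 0) hw (by omega)
    omega
  · have := U.exchange_two hr.excursion h.excursion (by omega) hw (h.walk 0) (by omega)
    omega

theorem exchange (h : IsChord s n i j) (h' : IsChord s n i' j') (hr : IsRun s n r)
    (U : UniqueWalk s x n) (hi : ¬ r.Mem i) (hne : ¬ (i < r.a ∧ r.a < j)) (hi' : ¬ r.Mem i')
    (hne' : ¬ (i' < r.a ∧ r.a < j')) (hd : j < i') {m m' c : ℕ}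
    (he : (j - i) * m + (j' - i') * m' + r.l * c = (j - i) + (j' - i') + r.l * r.turns) :
    (j - i) * m = j - i ∧ (j' - i') * m' = j' - i' := by
  have hlt := h.lt
  have hlt' := h'.lt
  have hL := hr.turns_mul_le
  rw [mul_comm] at hL
  have w₁ := h.walk m
  have w₂ := h'.walk m'
  have w₃ := hr.walk_turns c
  rcases h.lt_or_lt hr hi hne with h1 | h1 <;> rcases h'.lt_or_lt hr hi' hne' with h2 | h2
  · have := U.exchange_three h.excursion h'.excursion hr.excursion hd.le h2.le w₁ w₂ w₃ (by omega)
    omega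
  · have := U.exchange_three h.excursion hr.excursion h'.excursion h1.le (by omega) w₁ w₃ w₂
      (by omega)
    omega
  · omega
  · have := U.exchange_three hr.excursion h.excursion h'.excursion (by omega) hd.le w₃ w₁ w₂
      (by omega)
    omega

/-- For a run of period at most three there are no two disjoint chords that do not enclose it:
both could be traded for turns of the run, or one for the other and turns of the run. -/
theorem not_disjoint (h : IsChord s n i j) (h' : IsChord s n i' j') (hr : IsRun s n r)
    (U : UniqueWalk s x n) (hi : ¬ r.Mem i) (hne : ¬ (i < r.a ∧ r.a < j)) (hi' : ¬ r.Mem i')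
    (hne' : ¬ (i' < r.a ∧ r.a < j')) (hd : j < i') (hl : r.l ≤ 3) : False := by
  have hlt := h.lt
  have hlt' := h'.lt
  have n1 := h.not_dvd hr U hi hne
  have n2 := h'.not_dvd hr U hi' hne'
  have key := fun m m' c => h.exchange h' hr U hi hne hi' hne' hd (m := m) (m' := m') (c := c)
  have hpos := hr.pos
  generalize r.l = l at *
  by_cases hs : l ∣ (j - i) + (j' - i')
  · obtain ⟨c, hc⟩ := hs
    have := key 0 0 (r.turns + c) (by rw [mul_add]; omega)
    omega
  · have hl3 : l = 3 := by
      interval_cases l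
      · simp at n1
      · omega
      · rfl
    subst hl3
    generalize hA : j - i = A at *
    generalize hB : j' - i' = B at *
    have n3 : A % 3 = 1 ∨ A % 3 = 2 := by omega
    have n4 : B % 3 = 1 ∨ B % 3 = 2 := by omega
    have n5 : A % 3 = B % 3 := by omega
    rcases le_total A B with hle | hle
    · have := key 2 0 (r.turns + (B - A) / 3) (by omega)
      omega
    · have := key 0 2 (r.turns + (A - B) / 3) (by omega)
      omega

end IsChord

end

/-! ### The search -/

section

/-- `f n`; the case distinction makes a lazy evaluator compute the value of `n` before that
of `f`. -/
def forceNat {β : Type} (n : ℕ) (f : ℕ → β) : β := Nat.casesOn n (f 0) (fun m => f (Nat.succ m))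

@[simp] theorem forceNat_eq {β : Type} (n : ℕ) (f : ℕ → β) : forceNat n f = f n := by
  cases n <;> rfl

/-- The data of a search: the word (the binary digits of `w`, of which there are `n`), a bound `k`
for the sizes of blocks of parallel chords, a main run and a list of other runs. -/
structure Search where
  w : ℕ
  k : ℕ
  n : ℕ
  m : Run
  o : List Run

/-- All runs of a search. -/
def Search.runs (C : Search) : List Run := C.m :: C.o

/-- Whether the run `r` is enclosed by a chord from `i` to `j`. -/
def Run.within (r : Run) (i j : ℕ) : Bool := Nat.blt i r.a && Nat.blt r.a j

/-- A necessary condition for a chord from `i` to `t`, in the presence of the run `r` and the block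
of chords closed most recently: the closed walks that the chords create have lengths that cannot be
traded for turns of `r`. -/
def chordOK (i t : ℕ) (bl : List (ℕ × ℕ × ℕ)) (r : Run) : Bool :=
  bif r.within i t then
    !badLen r.l r.turns (t - i - r.turns * r.l) &&
    match bl with
    | [] => true
    | p :: _ => bif Nat.blt i p.1 then
        !badLen r.l r.turns ((p.1 - i) + (t - p.2.1) -
          bif r.within p.1 p.2.1 then 0 else r.turns * r.l)
        else true
  else
    !Nat.beq ((t - i) % r.l) 0 &&
    !badLen r.l r.turns (t - i) &&
    match bl with
    | [] => true
    | p :: _ =>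
        bif Nat.blt i p.1 then !badLen r.l r.turns ((p.1 - i) + (t - p.2.1)) else true

/-- The number of times of the run that starts at time `t`, or `0` if there is none. -/
def runAt (t : ℕ) : List Run → ℕ
  | [] => 0
  | r :: rs => bif Nat.beq t r.a then r.L + 1 else runAt t rs

/-- The earliest time known to have the same state as the time `u`, given the blocks `(i, j, b)` of
parallel chords from `i + e` to `j + e`, `e < b`. -/
def blockRep (bl : List (ℕ × ℕ × ℕ)) (u : ℕ) : ℕ := match bl with
  | [] => u
  | p :: bl => bif Nat.ble p.2.1 u && Nat.blt u (p.2.1 + p.2.2) then p.1 + (u - p.2.1)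
    else blockRep bl u

/-- The earliest time known to have the same state as the time `u`, given the runs and the blocks
of parallel chords. -/
def rep (rs : List Run) (bl : List (ℕ × ℕ × ℕ)) (u : ℕ) : ℕ := match rs with
  | [] => blockRep bl u
  | r :: rs =>
    bif Nat.ble r.a u && Nat.ble u (r.a + r.L) then r.a + (u - r.a) % r.l else rep rs bl u

/-- The edges traversed before time `m`. -/
def edges (rs : List Run) (bl : List (ℕ × ℕ × ℕ)) : ℕ → List (ℕ × ℕ)
  | 0 => []
  | m + 1 => (rep rs bl m, rep rs bl (m + 1)) :: edges rs bl m

/-- The set of targets of the edges with source in `F` (sets being encoded as bit masks). -/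
def fwd (E : List (ℕ × ℕ)) (F : ℕ) : ℕ := match E with
  | [] => 0
  | e :: E => bif Nat.testBit F e.1 then 2 ^ e.2 ||| fwd E F else fwd E F

/-- The set of sources of the edges with target in `F` (sets being encoded as bit masks). -/
def bwd (E : List (ℕ × ℕ)) (F : ℕ) : ℕ := match E with
  | [] => 0
  | e :: E => bif Nat.testBit F e.2 then 2 ^ e.1 ||| bwd E F else bwd E F

/-- The set of the times that belong to a run. -/
def runMask : List Run → ℕ
  | [] => 0
  | r :: rs => (2 ^ (r.L + 1) - 1) * 2 ^ r.a ||| runMask rs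

/-- The sets of vertices reachable from `v` in exactly `m, m - 1, …, 0` steps. -/
def fwds (E : List (ℕ × ℕ)) (v : ℕ) : ℕ → List ℕ
  | 0 => [2 ^ v]
  | m + 1 => match fwds E v m with
    | [] => []
    | F :: Fs => forceNat (fwd E F) fun G => G :: F :: Fs

/-- Whether some walk is off the runs at a time that belongs to a run. Here `Fs` lists the sets
reachable from the start in `m, m - 1, …, 0` steps, and `B` is the set of vertices from which the
end is reachable in the remaining number of steps. -/
def detourGo (E : List (ℕ × ℕ)) (mask : ℕ) : List ℕ → ℕ → Bool
  | [], _ => false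
  | F :: Fs, B => forceNat B fun B =>
      (Nat.testBit mask Fs.length && !Nat.beq (Nat.land (Nat.land F B) mask) (Nat.land F B)) ||
      detourGo E mask Fs (bwd E B)

/-- Whether, in the graph given by the runs and the blocks of chords, some walk of length `n` with
the right ends is off the runs at a time that belongs to a run. -/
def detour (n : ℕ) (rs : List Run) (bl : List (ℕ × ℕ × ℕ)) : Bool :=
  detourGo (edges rs bl n) (runMask rs) (fwds (edges rs bl n) (rep rs bl 0) n) (2 ^ rep rs bl n)

/-- The branches of the search in which a block of `b + 1` parallel chords, from the topmost
times in the stack to the times from `t` on, is closed; `g` is the search to go on with. Here `hd` is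
the top of the whole stack, and `b` of its elements have been removed already. -/
def closings (g : ℕ → List ℕ → ℕ → List (ℕ × ℕ × ℕ) → ℕ → Bool) (C : Search) (t c B : ℕ)
    (bl : List (ℕ × ℕ × ℕ)) (hd : ℕ) : ℕ → List ℕ → Bool
  | _, [] => true
  | b, i :: st =>
    bif Nat.beq (i + b) hd && Nat.blt b C.k && Nat.ble (t + b) C.n &&
        Nat.beq (runAt (t + b) C.runs) 0 then
      (bif (Nat.beq ((C.w >>> i) % 2 ^ b) ((C.w >>> t) % 2 ^ b)) &&
          (C.m.within i t || Nat.blt i c) && C.runs.all (chordOK i t bl) then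
        forceNat (t + b + 1) fun t' =>
        g t' st B ((i, t, b + 1) :: bl)
          (bif C.m.within i t || !C.o.isEmpty || Nat.ble c t then c else t)
      else true) && forceNat (b + 1) fun b' => closings g C t c B bl hd b' st
    else true

/-- Whether the numbers of times before and after the main run cannot be balanced. -/
def unbalanced (C : Search) (t len B c : ℕ) : Bool :=
  Nat.blt (C.n + 1 - t - bif Nat.blt t C.m.a then C.m.L + 1 else 0) len ||
  (C.o.isEmpty && Nat.blt t C.m.a &&
    ((Nat.ble c t && Nat.blt (len + (C.m.a - t) + B) (C.n - C.m.a - C.m.L)) ||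
    (Nat.beq c 0 && Nat.blt (C.n - C.m.a - C.m.L + B) (len + (C.m.a - t)))))

/-- Search through the time-ordered lists of chords; `true` means that there is no walk. The
arguments are: fuel, the present time `t`, the stack of the times before `t` whose state is visited
again from time `t` on, the number of remaining times off the runs whose state is visited only once,
the blocks of chords closed so far, and a bound `c` for the first ends of chords not enclosing the
main run. At a time off the runs the branches are: some chords are closed, a chord is opened, or the
state is visited only once. -/
def refute (C : Search) : ℕ → ℕ → List ℕ → ℕ → List (ℕ × ℕ × ℕ) → ℕ → Bool
  | 0, _, _, _, _, _ => false
  | f + 1, t, st, B, bl, c =>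
    bif Nat.blt C.n t then
      match st with
      | [] => detour C.n C.runs bl
      | _ :: _ => true
    else bif Nat.beq (runAt t C.runs) 0 then
      (forceNat st.length fun len => unbalanced C t len B c) ||
      ((Nat.beq c 0 && Nat.blt t C.m.a || match st with
        | [] => true
        | hd :: _ => closings (refute C f) C t c B bl hd 0 st) &&
       (bif Nat.blt t C.m.a || Nat.blt t c then
          forceNat (t + 1) fun t' => refute C f t' (t :: st) B bl c else true) &&
       (bif Nat.beq B 0 then true else
          forceNat (t + 1) fun t' => forceNat (B - 1) fun B' => refute C f t' st B' bl c))
    else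
      forceNat (t + runAt t C.runs) fun t' => refute C f t' st B bl c

end

/-! ### Necessary conditions on chords, and detours -/

section

variable {σ : Type*} {s : ℕ → σ} {C : Search}

/-- The time `u` belongs to no run of the search. -/
def Search.Free (C : Search) (u : ℕ) : Prop := ∀ r ∈ C.runs, ¬ r.Mem u

/-- The state at time `u` is off the runs and is visited at no other time. -/
def Search.Single (C : Search) (s : ℕ → σ) (u : ℕ) : Prop :=
  C.Free u ∧ ∀ v ≤ C.n, s v = s u → v = u

/-- `s` is a unique walk that reads the word of the search, in which the states off the runs are
visited at most twice and repeated factors have length less than `C.k`. -/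
structure Search.IsModel (C : Search) (s : ℕ → σ) : Prop where
  unique : UniqueWalk s C.w.testBit C.n
  isRun : ∀ r ∈ C.runs, IsRun s C.n r
  disjoint : ∀ r ∈ C.runs, ∀ r' ∈ C.runs, ∀ t, r.Mem t → r'.Mem t → r = r'
  twice : ∀ {i j u}, i < j → j < u → u ≤ C.n → s i = s j → s j = s u → ¬ C.Free i
  factor : ∀ {i j}, i < j → j + C.k ≤ C.n → ∃ e < C.k, C.w.testBit (i + e) ≠ C.w.testBit (j + e)
  period_le : C.o = [] → C.m.l ≤ 3

theorem Search.main_mem : C.m ∈ C.runs := List.mem_cons_self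

theorem Run.within_eq {r : Run} {i j : ℕ} : r.within i j = true ↔ i < r.a ∧ r.a < j := by
  simp [Run.within, Nat.blt_eq]

namespace Search.IsModel

/-- Skipping the turns of an enclosed run shortens a segment of the walk. -/
theorem walk_skip (h : C.IsModel s) {r : Run} (hr : r ∈ C.runs) {i j : ℕ}
    (hi : i ≤ r.a) (hj : r.a + r.L ≤ j) (hn : j ≤ C.n) :
    TraceWalk s C.n (j - i - r.turns * r.l) (s i) (s j) := by
  have H := h.isRun r hr
  have h1 := H.turns_mul_le
  have h2 := H.state_turn le_rfl
  rw [mul_comm] at h2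
  exact (TraceWalk.seg' (i := i) (j := r.a) (m := r.a - i) (by omega) (by omega) rfl h2.symm).trans
    (TraceWalk.seg' (i := r.a + r.turns * r.l) (j := j) (m := j - (r.a + r.turns * r.l)) (by omega)
      hn rfl rfl) (by omega)

/-- The condition `chordOK` holds for the chord closed at the present time: the chord, with the
turns of an enclosed run left out or with a shortcut along an inner chord, gives a closed walk at a
state off the run. -/
theorem chordOK (h : C.IsModel s) {i t : ℕ} {bl : List (ℕ × ℕ × ℕ)} (hc : IsChord s C.n i t)
    (hi : C.Free i) (hbl : ∀ p ∈ bl, IsChord s C.n p.1 p.2.1 ∧ C.Free p.1 ∧ p.2.1 < t)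
    {r : Run} (hr : r ∈ C.runs) : chordOK i t bl r = true := by
  have H := h.isRun r hr
  have hlt := hc.lt
  have hle := hc.le
  have hir := hi r hr
  have htr := hc.not_mem_right H hir
  have hL := H.turns_mul_le
  have hoff := fun {d : ℕ} => H.not_badLen h.unique (d := d) (by omega : i ≤ C.n) hir
  -- the closed walk through an inner chord
  have inner : ∀ p ∈ bl, i < p.1 → ∀ a b, TraceWalk s C.n a (s i) (s p.1) →
      TraceWalk s C.n b (s p.2.1) (s t) → 0 < a → badLen r.l r.turns (a + b) = false := by
    intro p hp hip a b wa wb ha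
    refine hoff ((wa.trans ?_ rfl)) (by omega)
    rw [(hbl p hp).1.eq, ← hc.eq] at *
    exact wb
  unfold _root_.chordOK
  by_cases hw : r.within i t = true
  · have hw' := Run.within_eq.1 hw
    have htL : r.a + r.L < t := by
      by_contra hh; exact htr ⟨by omega, by omega⟩
    rw [hw, cond_true, Bool.and_eq_true]
    constructor
    · have w := h.walk_skip hr hw'.1.le htL.le hle
      rw [← hc.eq] at w
      rw [hoff w (by omega)]; rfl
    · cases bl with
      | nil => rfl
      | cons p bl =>
        have hp := hbl p List.mem_cons_self
        simp only
        by_cases hip : i < p.1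
        · have hplt := hp.1.lt
          have hpr := hp.2.1 r hr
          have hpr' := hp.1.not_mem_right H hpr
          rw [show Nat.blt i p.1 = true from by rw [Nat.blt_eq]; exact hip, cond_true]
          by_cases hw2 : r.within p.1 p.2.1 = true
          · rw [hw2, cond_true, Nat.sub_zero, inner p List.mem_cons_self hip _ _
              (TraceWalk.seg hip.le (by omega)) (TraceWalk.seg hp.2.2.le hle) (by omega)]
            rfl
          · have hw3 : ¬ (p.1 < r.a ∧ r.a < p.2.1) := fun h => hw2 (Run.within_eq.2 h)
            rw [Bool.not_eq_true] at hw2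
            rw [hw2, cond_false]
            rcases hp.1.lt_or_lt H hpr hw3 with h3 | h3
            · have := inner p List.mem_cons_self hip _ _
                (TraceWalk.seg hip.le (by omega)) (h.walk_skip hr h3.le htL.le hle) (by omega)
              rw [show p.1 - i + (t - p.2.1) - r.turns * r.l =
                (p.1 - i) + (t - p.2.1 - r.turns * r.l) by omega, this]; rfl
            · have := inner p List.mem_cons_self hip _ _ (h.walk_skip hr hw'.1.le h3.le (by omega))
                (TraceWalk.seg hp.2.2.le hle) (by omega)
              rw [show p.1 - i + (t - p.2.1) - r.turns * r.l =
                (p.1 - i - r.turns * r.l) + (t - p.2.1) by omega, this]; rfl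
        · have : Nat.blt i p.1 = false := by rw [← Bool.not_eq_true, Nat.blt_eq]; exact hip
          rw [this]; rfl
  · have hw' : ¬ (i < r.a ∧ r.a < t) := fun h => hw (Run.within_eq.2 h)
    rw [Bool.not_eq_true] at hw
    rw [hw, cond_false, Bool.and_eq_true, Bool.and_eq_true]
    refine ⟨⟨?_, ?_⟩, ?_⟩
    · have := hc.not_dvd H h.unique hir hw'
      rw [Nat.dvd_iff_mod_eq_zero] at this
      rw [Bool.not_eq_true', ← Bool.not_eq_true, Nat.beq_eq]
      exact this
    · have w := hc.walk 1
      rw [mul_one] at w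
      rw [hoff w (by omega)]; rfl
    · cases bl with
      | nil => rfl
      | cons p bl =>
        have hp := hbl p List.mem_cons_self
        simp only
        by_cases hip : i < p.1
        · have hplt := hp.1.lt
          rw [show Nat.blt i p.1 = true from by rw [Nat.blt_eq]; exact hip, cond_true,
            inner p List.mem_cons_self hip _ _
              (TraceWalk.seg hip.le (by omega)) (TraceWalk.seg hp.2.2.le hle) (by omega)]
          rfl
        · have : Nat.blt i p.1 = false := by rw [← Bool.not_eq_true, Nat.blt_eq]; exact hip
          rw [this]; rfl

end Search.IsModel

theorem runMask_testBit {rs : List Run} {v : ℕ} :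
    (runMask rs).testBit v = true ↔ ∃ r ∈ rs, r.Mem v := by
  induction rs with
  | nil => simp [runMask]
  | cons r rs ih =>
    rw [runMask, Nat.testBit_or, Bool.or_eq_true, ih]
    have : ((2 ^ (r.L + 1) - 1) * 2 ^ r.a).testBit v = true ↔ r.Mem v := by
      rw [Nat.testBit_mul_two_pow, Nat.testBit_two_pow_sub_one]
      simp only [Bool.and_eq_true, decide_eq_true_eq, Run.Mem]
      omega
    rw [this]
    simp

theorem mem_fwd {E : List (ℕ × ℕ)} {F v : ℕ} (h : (fwd E F).testBit v = true) :
    ∃ e ∈ E, F.testBit e.1 = true ∧ v = e.2 := by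
  induction E with
  | nil => simp [fwd] at h
  | cons e E ih =>
    rw [fwd] at h
    cases he : F.testBit e.1 with
    | false =>
      rw [he, cond_false] at h
      obtain ⟨e', h1, h2⟩ := ih h
      exact ⟨e', List.mem_cons_of_mem _ h1, h2⟩
    | true =>
      rw [he, cond_true, Nat.testBit_or, Bool.or_eq_true, Nat.testBit_two_pow] at h
      rcases h with h | h
      · exact ⟨e, List.mem_cons_self, he, (of_decide_eq_true h).symm⟩
      · obtain ⟨e', h1, h2⟩ := ih h
        exact ⟨e', List.mem_cons_of_mem _ h1, h2⟩

theorem mem_bwd {E : List (ℕ × ℕ)} {F v : ℕ} (h : (bwd E F).testBit v = true) :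
    ∃ e ∈ E, F.testBit e.2 = true ∧ v = e.1 := by
  induction E with
  | nil => simp [bwd] at h
  | cons e E ih =>
    rw [bwd] at h
    cases he : F.testBit e.2 with
    | false =>
      rw [he, cond_false] at h
      obtain ⟨e', h1, h2⟩ := ih h
      exact ⟨e', List.mem_cons_of_mem _ h1, h2⟩
    | true =>
      rw [he, cond_true, Nat.testBit_or, Bool.or_eq_true, Nat.testBit_two_pow] at h
      rcases h with h | h
      · exact ⟨e, List.mem_cons_self, he, (of_decide_eq_true h).symm⟩
      · obtain ⟨e', h1, h2⟩ := ih h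
        exact ⟨e', List.mem_cons_of_mem _ h1, h2⟩

theorem rep_spec {n : ℕ} {rs : List Run} {bl : List (ℕ × ℕ × ℕ)} (hrs : ∀ r ∈ rs, IsRun s n r)
    (hbl : ∀ p ∈ bl, p.1 ≤ p.2.1 ∧ ∀ e < p.2.2, s (p.1 + e) = s (p.2.1 + e)) {u : ℕ} (hu : u ≤ n) :
    rep rs bl u ≤ u ∧ s (rep rs bl u) = s u := by
  induction rs with
  | nil =>
    rw [rep]
    induction bl with
    | nil => simp [blockRep]
    | cons p bl ih =>
      have hp := hbl p List.mem_cons_self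
      rw [blockRep]
      cases hc : Nat.ble p.2.1 u && Nat.blt u (p.2.1 + p.2.2) with
      | false => exact ih fun q hq => hbl q (List.mem_cons_of_mem _ hq)
      | true =>
        rw [Bool.and_eq_true, Nat.ble_eq, Nat.blt_eq] at hc
        rw [cond_true]
        refine ⟨by omega, ?_⟩
        rw [hp.2 _ (by omega)]
        congr 1; omega
  | cons r rs ih =>
    have H := hrs r List.mem_cons_self
    rw [rep]
    cases hc : Nat.ble r.a u && Nat.ble u (r.a + r.L) with
    | false => exact ih fun q hq => hrs q (List.mem_cons_of_mem _ hq)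
    | true =>
      rw [Bool.and_eq_true, Nat.ble_eq, Nat.ble_eq] at hc
      rw [cond_true]
      have h1 := Nat.mod_le (u - r.a) r.l
      refine ⟨by omega, (H.iff hc (by omega)).2 ⟨⟨by omega, by omega⟩, ?_⟩⟩
      conv_rhs => rw [show u = r.a + (u - r.a) by omega]
      exact Nat.ModEq.add_left _ (Nat.mod_modEq _ _)

theorem mem_edges {rs : List Run} {bl : List (ℕ × ℕ × ℕ)} {m : ℕ} {e : ℕ × ℕ}
    (h : e ∈ edges rs bl m) : ∃ u < m, e = (rep rs bl u, rep rs bl (u + 1)) := by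
  induction m with
  | zero => simp [edges] at h
  | succ m ih =>
    rw [edges, List.mem_cons] at h
    rcases h with h | h
    · exact ⟨m, by omega, h⟩
    · obtain ⟨u, hu, he⟩ := ih h
      exact ⟨u, by omega, he⟩

theorem TraceWalk.snoc {n m : ℕ} {p q q' : σ} (h : TraceWalk s n m p q) (h' : TraceStep s n q q') :
    TraceWalk s n (m + 1) p q' :=
  h.trans (b := 1) ⟨q', h', rfl⟩ rfl

/-- Every set of a list of sets of times, each being reachable in as many steps as there are sets
after it. -/
def AllReach (s : ℕ → σ) (n : ℕ) : List ℕ → Prop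
  | [] => True
  | F :: Fs => (∀ v, F.testBit v = true → v ≤ n ∧ TraceWalk s n Fs.length (s 0) (s v)) ∧
      AllReach s n Fs

theorem allReach_fwds {n v : ℕ} {E : List (ℕ × ℕ)}
    (hE : ∀ e ∈ E, e.2 ≤ n ∧ TraceStep s n (s e.1) (s e.2)) (hv : v ≤ n) (hs : s v = s 0) (m : ℕ) :
    AllReach s n (fwds E v m) ∧ (fwds E v m).length = m + 1 := by
  induction m with
  | zero =>
    refine ⟨⟨?_, trivial⟩, rfl⟩
    intro u hu
    rw [Nat.testBit_two_pow, decide_eq_true_eq] at hu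
    subst hu
    exact ⟨hv, hs.symm⟩
  | succ m ih =>
    rw [fwds]
    cases hF : fwds E v m with
    | nil => simp [hF] at ih
    | cons F Fs =>
      rw [hF] at ih
      simp only [forceNat_eq]
      refine ⟨⟨?_, ih.1⟩, by simpa using ih.2⟩
      intro u hu
      obtain ⟨e, he, hFe, rfl⟩ := mem_fwd hu
      exact ⟨(hE e he).1, (ih.1.1 _ hFe).2.snoc (hE e he).2⟩

/-- A walk of length `n` with the right ends is the walk `s`, so it is on the runs when `s` is. -/
theorem not_detourGo {n : ℕ} {E : List (ℕ × ℕ)} (rs : List Run) {x : ℕ → Bool}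
    (U : UniqueWalk s x n) (hrs : ∀ r ∈ rs, IsRun s n r)
    (hE : ∀ e ∈ E, TraceStep s n (s e.1) (s e.2)) (Fs : List ℕ) (B : ℕ) (hF : AllReach s n Fs)
    (hlen : Fs.length ≤ n + 1)
    (hB : ∀ v, B.testBit v = true → TraceWalk s n (n + 1 - Fs.length) (s v) (s n)) :
    detourGo E (runMask rs) Fs B = false := by
  induction Fs generalizing B with
  | nil => rfl
  | cons F Fs ih =>
    rw [detourGo, forceNat_eq, Bool.or_eq_false_iff]
    rw [List.length_cons] at hlen hB
    constructor
    · rw [← Bool.not_eq_true, Bool.and_eq_true, runMask_testBit, Bool.not_eq_true',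
        ← Bool.not_eq_true, Nat.beq_eq]
      rintro ⟨⟨r, hr, hmem⟩, hne⟩
      apply hne
      refine Nat.eq_of_testBit_eq fun v => ?_
      change ((F &&& B) &&& runMask rs).testBit v = (F &&& B).testBit v
      rw [Nat.testBit_and]
      cases hv : (F &&& B).testBit v with
      | false => rfl
      | true =>
        rw [Nat.testBit_and, Bool.and_eq_true] at hv
        obtain ⟨h1, h2⟩ := hF.1 v hv.1
        have h3 : s v = s Fs.length :=
          U.eq_of_walk (b := n + 1 - (Fs.length + 1)) (by omega) h2 (hB v hv.2)
        rw [Bool.true_and, runMask_testBit]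
        exact ⟨r, hr, (((hrs r hr).iff hmem h1).1 h3).1⟩
    · refine ih (bwd E B) hF.2 (by omega) fun v hv => ?_
      obtain ⟨e, he, hBe, rfl⟩ := mem_bwd hv
      have := hB _ hBe
      rw [show n + 1 - Fs.length = (n + 1 - (Fs.length + 1)) + 1 by omega]
      exact ⟨_, hE e he, this⟩

theorem Search.IsModel.not_detour (h : C.IsModel s) {bl : List (ℕ × ℕ × ℕ)}
    (hbl : ∀ p ∈ bl, p.1 ≤ p.2.1 ∧ ∀ e < p.2.2, s (p.1 + e) = s (p.2.1 + e)) :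
    detour C.n C.runs bl = false := by
  have hrep := fun {u} (hu : u ≤ C.n) => rep_spec h.isRun hbl hu
  have hE : ∀ e ∈ edges C.runs bl C.n, e.2 ≤ C.n ∧ TraceStep s C.n (s e.1) (s e.2) := by
    intro e he
    obtain ⟨u, hu, rfl⟩ := mem_edges he
    exact ⟨(hrep (by omega : u + 1 ≤ C.n)).1.trans (by omega), u, hu, (hrep (by omega)).2.symm,
      (hrep (by omega)).2.symm⟩
  have hF := allReach_fwds hE (v := rep C.runs bl 0)
    ((hrep (Nat.zero_le _)).1.trans (Nat.zero_le _))
    (hrep (Nat.zero_le _)).2 C.n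
  refine not_detourGo _ h.unique h.isRun (fun e he => (hE e he).2) _ _ hF.1 hF.2.le fun v hv => ?_
  rw [hF.2, Nat.sub_self]
  rw [Nat.testBit_two_pow, decide_eq_true_eq] at hv
  subst hv
  exact (hrep le_rfl).2

end

/-! ### The invariant of the search -/

section

variable {σ : Type*} {s : ℕ → σ} {C : Search}

theorem runAt_eq_zero {t : ℕ} {rs : List Run} (h : runAt t rs = 0) : ∀ r ∈ rs, r.a ≠ t := by
  induction rs with
  | nil => simp
  | cons r rs ih =>
    rw [runAt] at h
    cases hb : Nat.beq t r.a with
    | true => rw [hb, cond_true] at h; omega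
    | false =>
      rw [hb, cond_false] at h
      rw [← Bool.not_eq_true, Nat.beq_eq] at hb
      intro r' hr'
      rcases List.mem_cons.1 hr' with rfl | hr'
      · exact fun h => hb h.symm
      · exact ih h r' hr'

theorem runAt_ne_zero {t : ℕ} {rs : List Run} (h : runAt t rs ≠ 0) :
    ∃ r ∈ rs, r.a = t ∧ runAt t rs = r.L + 1 := by
  induction rs with
  | nil => simp [runAt] at h
  | cons r rs ih =>
    rw [runAt] at h ⊢
    cases hb : Nat.beq t r.a with
    | true =>
      rw [Nat.beq_eq] at hb
      exact ⟨r, List.mem_cons_self, hb.symm, rfl⟩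
    | false =>
      rw [hb, cond_false] at h
      obtain ⟨r', h1, h2⟩ := ih h
      exact ⟨r', List.mem_cons_of_mem _ h1, h2⟩

namespace Search.IsModel

theorem free_congr (h : C.IsModel s) {t u : ℕ} (ht : C.Free t) (htn : t ≤ C.n)
    (hs : s u = s t) : C.Free u :=
  fun r hr hur => ht r hr (((h.isRun r hr).iff hur htn).1 hs.symm).1

theorem chord_of_eq (h : C.IsModel s) {i j : ℕ} (hi : C.Free i) (hij : i < j) (hj : j ≤ C.n)
    (hs : s i = s j) : IsChord s C.n i j where
  lt := hij
  le := hj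
  eq := hs
  only u hu hsu := by
    by_contra hne
    push Not at hne
    rcases lt_trichotomy u i with h1 | h1 | h1
    · exact h.twice h1 hij hj hsu hs (h.free_congr hi (by omega) hsu)
    · exact hne.1 h1
    · rcases lt_trichotomy u j with h2 | h2 | h2
      · exact h.twice h1 h2 hj hsu.symm (hsu.trans hs) hi
      · exact hne.2 h2
      · exact h.twice hij h2 hu hs (hs.symm.trans hsu.symm) hi

/-- A time off the runs at which the state is not visited only once is an end of a chord. -/
theorem single_or_chord (h : C.IsModel s) {t : ℕ} (ht : C.Free t) (htn : t ≤ C.n) :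
    C.Single s t ∨ (∃ v, IsChord s C.n t v) ∨ ∃ i, IsChord s C.n i t ∧ C.Free i := by
  by_cases hS : C.Single s t
  · exact Or.inl hS
  · right
    simp only [Single, not_and, not_forall] at hS
    obtain ⟨v, hv, hs, hne⟩ := hS ht
    rcases lt_or_gt_of_ne hne with h1 | h1
    · have := h.free_congr ht htn hs
      exact Or.inr ⟨v, h.chord_of_eq this h1 htn hs, this⟩
    · exact Or.inl ⟨v, h.chord_of_eq ht h1 hv hs.symm⟩

open scoped Classical in
/-- If the times in `S` that are not single are ends of chords with the other end in `T`, then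
`S` has at most as many elements as `T` and the set of single times together. -/
theorem card_le (h : C.IsModel s) (S T : Finset ℕ) {t B : ℕ} (hS : ∀ u ∈ S, u ≤ C.n ∧ C.Free u)
    (hST : ∀ u ∈ S, (t ≤ u ∧ C.Single s u) ∨ ∃ v ∈ T, v ≤ C.n ∧ s v = s u ∧ v ≠ u)
    (hB : ((Finset.Icc t C.n).filter (C.Single s)).card ≤ B) : S.card ≤ T.card + B := by
  have hf : ∀ u, ∃ v, u ∈ S → ¬ (t ≤ u ∧ C.Single s u) → v ∈ T ∧ v ≤ C.n ∧ s v = s u ∧ v ≠ u := by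
    intro u
    by_cases hu : u ∈ S
    · rcases hST u hu with h1 | ⟨v, hv⟩
      · exact ⟨0, fun _ h2 => absurd h1 h2⟩
      · exact ⟨v, fun _ _ => hv⟩
    · exact ⟨0, fun h => absurd h hu⟩
  choose f hf using hf
  have h1 : (S.filter fun u => t ≤ u ∧ C.Single s u).card ≤ B := by
    refine (Finset.card_le_card fun u hu => ?_).trans hB
    rw [Finset.mem_filter] at hu ⊢
    exact ⟨Finset.mem_Icc.2 ⟨hu.2.1, (hS u hu.1).1⟩, hu.2.2⟩
  have h2 : (S.filter fun u => ¬ (t ≤ u ∧ C.Single s u)).card ≤ T.card := by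
    refine Finset.card_le_card_of_injOn f (fun u hu => ?_) fun u hu v hv huv => ?_
    · have hu' := Finset.mem_filter.1 (Finset.mem_coe.1 hu)
      exact (hf u hu'.1 hu'.2).1
    · have hu' := Finset.mem_filter.1 (Finset.mem_coe.1 hu)
      have hv' := Finset.mem_filter.1 (Finset.mem_coe.1 hv)
      obtain ⟨-, a1, a2, a3⟩ := hf u hu'.1 hu'.2
      obtain ⟨-, b1, b2, b3⟩ := hf v hv'.1 hv'.2
      rw [← huv] at b1 b2 b3
      obtain ⟨hun, huf⟩ := hS u hu'.1
      obtain ⟨hvn, hvf⟩ := hS v hv'.1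
      have huv : s u = s v := a2.symm.trans b2
      by_contra hne
      rcases lt_or_gt_of_ne hne with hlt | hlt
      · rcases (h.chord_of_eq huf hlt hvn huv).only _ a1 a2 with h | h
        · exact a3 h
        · exact b3 h
      · rcases (h.chord_of_eq hvf hlt hun huv.symm).only _ a1 b2 with h | h
        · exact b3 h
        · exact a3 h
  have := Finset.card_filter_add_card_filter_not (s := S) (fun u => t ≤ u ∧ C.Single s u)
  omega

end Search.IsModel

open scoped Classical in
/-- The meaning of the arguments of `refute`. -/
structure Search.Inv (C : Search) (s : ℕ → σ) (t : ℕ) (st : List ℕ) (B : ℕ)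
    (bl : List (ℕ × ℕ × ℕ)) (c : ℕ) : Prop where
  runs : ∀ r ∈ C.runs, t ≤ r.a ∨ r.a + r.L < t
  sorted : st.Pairwise (· > ·)
  mem_stack : ∀ {u}, u ∈ st ↔ u < t ∧ C.Free u ∧ ∃ v, t ≤ v ∧ IsChord s C.n u v
  singles : ((Finset.Icc t C.n).filter (C.Single s)).card ≤ B
  blocks : ∀ p ∈ bl, IsChord s C.n p.1 p.2.1 ∧ C.Free p.1 ∧ p.2.1 < t ∧
    ∀ e < p.2.2, s (p.1 + e) = s (p.2.1 + e)
  opener : ∀ {i j}, IsChord s C.n i j → C.Free i → ¬ (i < C.m.a ∧ C.m.a < j) → i < c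

namespace Search.Inv

variable {t B c : ℕ} {st : List ℕ} {bl : List (ℕ × ℕ × ℕ)}

theorem singles_mono (I : C.Inv s t st B bl c) {t' : ℕ} (ht : t ≤ t') :
    by classical exact ((Finset.Icc t' C.n).filter (C.Single s)).card ≤ B := by
  classical
  refine (Finset.card_le_card ?_).trans (I.singles)
  exact Finset.filter_subset_filter _ (Finset.Icc_subset_Icc_left ht)

theorem free (I : C.Inv s t st B bl c) (h : runAt t C.runs = 0) : C.Free t := by
  intro r hr hm
  have := runAt_eq_zero h r hr
  have := I.runs r hr
  simp only [Run.Mem] at hm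
  omega

/-- The invariant is kept on skipping a run. -/
theorem jump (I : C.Inv s t st B bl c) (h : C.IsModel s) {r : Run} (hr : r ∈ C.runs)
    (hrt : r.a = t) : C.Inv s (t + (r.L + 1)) st B bl c where
  runs r' hr' := by
    rcases I.runs r' hr' with h1 | h1
    · by_contra hh
      push Not at hh
      have := h.disjoint r hr r' hr' r'.a ⟨by omega, by omega⟩ ⟨le_rfl, by omega⟩
      subst this
      omega
    · right; omega
  sorted := I.sorted
  mem_stack {u} := by
    rw [I.mem_stack]
    constructor
    · rintro ⟨h1, h2, v, h3, h4⟩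
      have := h4.not_mem_right (h.isRun r hr) (h2 r hr)
      simp only [Run.Mem] at this
      exact ⟨by omega, h2, v, by omega, h4⟩
    · rintro ⟨h1, h2, v, h3, h4⟩
      have := h2 r hr
      simp only [Run.Mem] at this
      exact ⟨by omega, h2, v, by omega, h4⟩
  singles := I.singles_mono (by omega)
  blocks p hp := by
    obtain ⟨h1, h2, h3, h4⟩ := I.blocks p hp
    exact ⟨h1, h2, by omega, h4⟩
  opener := I.opener

/-- The invariant is kept on passing a single time. -/
theorem single (I : C.Inv s t st B bl c) (htn : t ≤ C.n) (h0 : runAt t C.runs = 0)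
    (ht : C.Single s t) : B ≠ 0 ∧ C.Inv s (t + 1) st (B - 1) bl c := by
  classical
  have hI := I.singles
  have hcard : ((Finset.Icc (t + 1) C.n).filter (C.Single s)).card + 1 ≤ B := by
    rw [← Finset.card_insert_of_notMem (a := t) (by simp)]
    refine (Finset.card_le_card ?_).trans hI
    intro u hu
    rw [Finset.mem_insert, Finset.mem_filter, Finset.mem_Icc] at hu
    rw [Finset.mem_filter, Finset.mem_Icc]
    rcases hu with rfl | ⟨h1, h2⟩
    · exact ⟨by omega, ht⟩
    · exact ⟨by omega, h2⟩
  refine ⟨by omega, fun r hr => ?_, I.sorted, fun {u} => ?_, ?_, fun p hp => ?_, I.opener⟩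
  · have := I.runs r hr
    have := runAt_eq_zero h0 r hr
    omega
  · rw [I.mem_stack]
    constructor
    · rintro ⟨h1, h2, v, h3, h4⟩
      refine ⟨by omega, h2, v, ?_, h4⟩
      by_contra hh
      obtain rfl : v = t := by omega
      have := ht.2 u (by omega) h4.eq
      omega
    · rintro ⟨h1, h2, v, h3, h4⟩
      refine ⟨?_, h2, v, by omega, h4⟩
      by_contra hh
      obtain rfl : u = t := by omega
      have := ht.2 v h4.le h4.eq.symm
      omega
  · exact Nat.le_sub_of_add_le hcard
  · obtain ⟨h1, h2, h3, h4⟩ := I.blocks p hp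
    exact ⟨h1, h2, by omega, h4⟩

/-- The invariant is kept on passing the first end of a chord. -/
theorem opens (I : C.Inv s t st B bl c) (h0 : runAt t C.runs = 0) {v : ℕ}
    (hv : IsChord s C.n t v) : C.Inv s (t + 1) (t :: st) B bl c := by
  refine ⟨fun r hr => ?_, ?_, fun {u} => ?_,
    I.singles_mono (by omega), fun p hp => ?_, I.opener⟩
  · have := I.runs r hr
    have := runAt_eq_zero h0 r hr
    omega
  · exact List.pairwise_cons.2 ⟨fun u hu => (I.mem_stack.1 hu).1, I.sorted⟩
  · rw [List.mem_cons, I.mem_stack]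
    constructor
    · rintro (rfl | ⟨h1, h2, w, h3, h4⟩)
      · exact ⟨by omega, I.free h0, v, hv.lt, hv⟩
      · refine ⟨by omega, h2, w, ?_, h4⟩
        by_contra hh
        obtain rfl : w = t := by omega
        have := h4.only v hv.le (hv.eq.symm.trans h4.eq.symm)
        have := hv.lt
        omega
    · rintro ⟨h1, h2, w, h3, h4⟩
      by_cases hu : u = t
      · exact Or.inl hu
      · exact Or.inr ⟨by omega, h2, w, by omega, h4⟩
  · obtain ⟨h1, h2, h3, h4⟩ := I.blocks p hp
    exact ⟨h1, h2, by omega, h4⟩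

end Search.Inv

/-- If the topmost times in the stack, down to `i`, can be matched with the times from `t` on, then
one of the branches in `closings` closes the corresponding block of chords. -/
theorem closings_spec {g : ℕ → List ℕ → ℕ → List (ℕ × ℕ × ℕ) → ℕ → Bool} {t c B hd i b : ℕ}
    {bl : List (ℕ × ℕ × ℕ)} {st : List ℕ} (h : closings g C t c B bl hd b st = true)
    (hst : st.Pairwise (· > ·)) (hib : i + b ≤ hd) (hmem : ∀ e, i + e + b ≤ hd → i + e ∈ st)
    (hle : ∀ u ∈ st, u + b ≤ hd)
    (hb : ∀ b, i + b ≤ hd → b < C.k ∧ t + b ≤ C.n ∧ runAt (t + b) C.runs = 0)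
    (hw : (C.w >>> i) % 2 ^ (hd - i) = (C.w >>> t) % 2 ^ (hd - i))
    (hc : C.m.within i t = true ∨ i < c) (hok : ∀ r ∈ C.runs, chordOK i t bl r = true) :
    g (t + (hd - i) + 1) (st.filter (· < i)) B ((i, t, hd - i + 1) :: bl)
      (bif C.m.within i t || !C.o.isEmpty || Nat.ble c t then c else t) = true := by
  induction st generalizing b with
  | nil => simpa using hmem 0 (by omega)
  | cons j st ih =>
    have hj := hle j List.mem_cons_self
    rw [List.pairwise_cons] at hst
    have hjh : j + b = hd := by
      have h1 := hmem (hd - b - i) (by omega)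
      rcases List.mem_cons.1 h1 with h2 | h2
      · omega
      · have := hst.1 _ h2
        omega
    have hij : i ≤ j := by omega
    obtain ⟨b1, b2, b3⟩ := hb b hib
    have hcond : (Nat.beq (j + b) hd && Nat.blt b C.k && Nat.ble (t + b) C.n &&
        Nat.beq (runAt (t + b) C.runs) 0) = true := by
      simp only [Bool.and_eq_true, Nat.beq_eq, Nat.blt_eq, Nat.ble_eq]
      exact ⟨⟨⟨hjh, b1⟩, b2⟩, b3⟩
    rw [closings, hcond, cond_true, Bool.and_eq_true, forceNat_eq, forceNat_eq] at h
    rcases eq_or_lt_of_le hij with h1 | h1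
    · subst h1
      have hbd : b = hd - i := by omega
      have hcond2 : ((Nat.beq ((C.w >>> i) % 2 ^ b) ((C.w >>> t) % 2 ^ b)) &&
          (C.m.within i t || Nat.blt i c) && C.runs.all (chordOK i t bl)) = true := by
        simp only [Bool.and_eq_true, Nat.beq_eq, Bool.or_eq_true, Nat.blt_eq, List.all_eq_true]
        exact ⟨⟨hbd ▸ hw, hc⟩, hok⟩
      rw [hcond2, cond_true] at h
      rw [List.filter_cons_of_neg (by simp), List.filter_eq_self.2 (by simpa using hst.1), ← hbd]
      exact h.1
    · rw [List.filter_cons_of_neg (by simpa using h1.le)]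
      refine ih (b := b + 1) h.2 hst.2 (by omega) (fun e he => ?_) fun u hu => ?_
      · rcases List.mem_cons.1 (hmem e (by omega)) with h2 | h2
        · omega
        · exact h2
      · have := hst.1 u hu
        omega

end

/-! ### Correctness of the search -/

section

variable {σ : Type*} {s : ℕ → σ} {C : Search}

namespace Search.Inv

variable {t B c : ℕ} {st : List ℕ} {bl : List (ℕ × ℕ × ℕ)}

/-- The chords that start between `i` and the top `hd` of the stack, when the chord that starts
at `i` ends at the present time `t`. -/
theorem parallel (I : C.Inv s t st B bl c) (h : C.IsModel s) {i hd : ℕ} (hc : IsChord s C.n i t)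
    (hhd : hd ∈ st) (hihd : i ≤ hd) :
    t + (hd - i) ≤ C.n ∧ ∀ e, i + e ≤ hd → s (i + e) = s (t + e) ∧ IsChord s C.n (i + e) (t + e) ∧
      C.Free (i + e) ∧ C.Free (t + e) := by
  obtain ⟨h1, h2, v, h3, h4⟩ := I.mem_stack.1 hhd
  have h4le := h4.le
  have h4lt := h4.lt
  have key : t + (hd - i) ≤ C.n ∧ ∀ e, i + e ≤ hd → s (i + e) = s (t + e) := by
    rcases eq_or_lt_of_le hihd with h5 | h5
    · subst h5
      refine ⟨by have := hc.le; omega, fun e he => ?_⟩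
      obtain rfl : e = 0 := by omega
      exact hc.eq
    · have h6 : v ≠ t := by
        rintro rfl
        have := h4.only i (by omega) (hc.eq.trans h4.eq.symm)
        omega
      obtain ⟨h7, h8⟩ := hc.crossing h4 h.unique h5 h1 (by omega)
      exact ⟨by omega, h8⟩
  refine ⟨key.1, fun e he => ?_⟩
  have hs := key.2 e he
  have hf : C.Free (i + e) := by
    intro r hr hm
    have h5 := (((h.isRun r hr).iff hm (by omega)).1 hs.symm).1
    simp only [Run.Mem] at hm h5
    exact h2 r hr ⟨by omega, by omega⟩
  exact ⟨hs, h.chord_of_eq hf (by omega) (by omega) hs, hf, h.free_congr hf (by omega) hs.symm⟩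

/-- The invariant is kept on closing all parallel chords from the topmost one down to the one that
ends at the present time. The new bound for the chords not enclosing the main run is due to
`IsChord.not_disjoint`. -/
theorem closes (I : C.Inv s t st B bl c) (h : C.IsModel s) {i hd : ℕ} (hc : IsChord s C.n i t)
    (hi : C.Free i) (hhd : hd ∈ st) (hihd : i ≤ hd) (hle : ∀ u ∈ st, u ≤ hd) :
    C.Inv s (t + (hd - i) + 1) (st.filter (· < i)) B ((i, t, hd - i + 1) :: bl)
      (bif C.m.within i t || !C.o.isEmpty || Nat.ble c t then c else t) := by
  obtain ⟨hn, hpar⟩ := I.parallel h hc hhd hihd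
  have hhdt := (I.mem_stack.1 hhd).1
  refine ⟨fun r hr => ?_, I.sorted.filter _, fun {u} => ?_, I.singles_mono (by omega),
    fun p hp => ?_, fun {i' j'} hc' hi' hne => ?_⟩
  · rcases I.runs r hr with h1 | h1
    · by_contra hh
      have := (hpar (r.a - t) (by omega)).2.2.2
      rw [show t + (r.a - t) = r.a by omega] at this
      exact this r hr ⟨le_rfl, by omega⟩
    · right; omega
  · rw [List.mem_filter, I.mem_stack, decide_eq_true_eq]
    constructor
    · rintro ⟨⟨h1, h2, v, h3, h4⟩, h5⟩
      refine ⟨by omega, h2, v, ?_, h4⟩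
      by_contra hh
      obtain ⟨-, h6, -⟩ := hpar (v - t) (by omega)
      rw [show t + (v - t) = v by omega] at h6
      have := h6.only u (by omega) (h4.eq.trans h6.eq.symm)
      omega
    · rintro ⟨h1, h2, v, h3, h4⟩
      have hut : u < t := by
        by_contra hh
        obtain ⟨-, h6, -⟩ := hpar (u - t) (by omega)
        rw [show t + (u - t) = u by omega] at h6
        have := h6.only v h4.le (h4.eq.symm.trans h6.eq.symm)
        omega
      refine ⟨⟨hut, h2, v, by omega, h4⟩, ?_⟩
      by_contra hh
      have h5 := hle u (I.mem_stack.2 ⟨hut, h2, v, by omega, h4⟩)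
      obtain ⟨-, h6, -⟩ := hpar (u - i) (by omega)
      rw [show i + (u - i) = u by omega] at h6
      have := h6.only v h4.le h4.eq.symm
      omega
  · rcases List.mem_cons.1 hp with rfl | hp
    · exact ⟨hc, hi, by simp only; omega, fun e he => (hpar e (by simp only at he; omega)).1⟩
    · obtain ⟨h1, h2, h3, h4⟩ := I.blocks p hp
      exact ⟨h1, h2, by omega, h4⟩
  · cases hb : C.m.within i t || !C.o.isEmpty || Nat.ble c t with
    | true => exact I.opener hc' hi' hne
    | false =>
      rw [cond_false]
      rw [Bool.or_eq_false_iff, Bool.or_eq_false_iff, ← Bool.not_eq_true, Run.within_eq,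
        Bool.not_eq_false', List.isEmpty_iff] at hb
      by_contra hh
      have hne' : i' ≠ t := by
        rintro rfl
        have := hc.only j' hc'.le (hc'.eq.symm.trans hc.eq.symm)
        have := hc'.lt
        have := hc.lt
        omega
      exact hc.not_disjoint hc' (h.isRun C.m C.main_mem) h.unique (hi _ C.main_mem) hb.1.1
        (hi' _ C.main_mem) hne (by omega) (h.period_le hb.1.2)

/-- At a time that is the second end of a chord, some branch of `closings` leads on. -/
theorem not_closings (I : C.Inv s t st B bl c) (h : C.IsModel s) {i hd : ℕ} {st' : List ℕ}
    {g : ℕ → List ℕ → ℕ → List (ℕ × ℕ × ℕ) → ℕ → Bool} (hst : st = hd :: st')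
    (hc : IsChord s C.n i t) (hi : C.Free i)
    (hg : ∀ t' st B bl c, t < t' → C.Inv s t' st B bl c → g t' st B bl c = false) :
    closings g C t c B bl hd 0 st = false := by
  have hist : i ∈ st := I.mem_stack.2 ⟨hc.lt, hi, t, le_rfl, hc⟩
  have hsort := I.sorted
  have hle : ∀ u ∈ st, u ≤ hd := by
    rw [hst] at hsort ⊢
    rw [List.pairwise_cons] at hsort
    intro u hu
    rcases List.mem_cons.1 hu with rfl | hu
    · exact le_rfl
    · exact (hsort.1 u hu).le
  have hhd : hd ∈ st := hst ▸ List.mem_cons_self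
  have hihd := hle i hist
  have hhdt := (I.mem_stack.1 hhd).1
  have hlt := hc.lt
  obtain ⟨hn, hpar⟩ := I.parallel h hc hhd hihd
  have hlab : ∀ e, i + e < hd → C.w.testBit (i + e) = C.w.testBit (t + e) := by
    intro e he
    refine h.unique.label_eq (by omega) (by omega) (hpar e (by omega)).1 ?_
    exact (hpar (e + 1) (by omega)).1
  have hk : hd - i < C.k := by
    by_contra hh
    obtain ⟨e, he, hne⟩ := h.factor hlt (by omega)
    exact hne (hlab e (by omega))
  rw [← Bool.not_eq_true]
  intro hcl
  have := closings_spec hcl hsort hihd (fun e he => ?_) (fun u hu => by simpa using hle u hu)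
    (fun b hb => ?_) ?_ ?_ (fun r hr => ?_)
  · rw [hg _ _ _ _ _ (by omega) (I.closes h hc hi hhd hihd hle)] at this
    exact absurd this (by simp)
  · exact I.mem_stack.2 ⟨by omega, (hpar e (by omega)).2.2.1, t + e, by omega,
      (hpar e (by omega)).2.1⟩
  · refine ⟨by omega, by omega, ?_⟩
    by_contra h0
    obtain ⟨r, hr, h1, -⟩ := runAt_ne_zero h0
    exact (hpar b hb).2.2.2 r hr ⟨by omega, by omega⟩
  · refine Nat.eq_of_testBit_eq fun e => ?_
    rw [Nat.testBit_mod_two_pow, Nat.testBit_mod_two_pow, Nat.testBit_shiftRight,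
      Nat.testBit_shiftRight]
    by_cases he : e < hd - i
    · rw [hlab e (by omega)]
    · simp [he]
  · by_cases hw : C.m.within i t = true
    · exact Or.inl hw
    · exact Or.inr (I.opener hc hi fun h => hw (Run.within_eq.2 h))
  · exact h.chordOK hc hi (fun p hp => ⟨(I.blocks p hp).1, (I.blocks p hp).2.1,
      (I.blocks p hp).2.2.1⟩) hr

/-- Open chords need distinct second ends later on. If no chord on one side of a single run avoids
enclosing it, then the chords match the times on that side, up to single times, with times on the
other side. -/
theorem not_unbalanced (I : C.Inv s t st B bl c) (h : C.IsModel s) (ht : C.Free t) :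
    unbalanced C t st.length B c = false := by
  classical
  have hst : st.toFinset.card = st.length :=
    List.toFinset_card_of_nodup (I.sorted.imp fun h => (Nat.ne_of_gt h))
  have H := h.isRun C.m C.main_mem
  have hmn := H.le
  have htm := ht C.m C.main_mem
  simp only [Run.Mem] at htm
  have hfree : C.o = [] → ∀ u, ¬ C.m.Mem u → C.Free u := by
    intro ho u hu r hr
    rw [Search.runs, ho, List.mem_singleton] at hr
    rwa [hr]
  rw [← Bool.not_eq_true]
  unfold unbalanced
  simp only [Bool.or_eq_true, Bool.and_eq_true, Nat.blt_eq, Nat.ble_eq, Nat.beq_eq,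
    List.isEmpty_iff]
  rintro (h1 | ⟨⟨ho, hta⟩, ⟨hct, h1⟩ | ⟨rfl, h1⟩⟩)
  · have hcard := h.card_le (t := C.n + 1) (B := 0) st.toFinset
      ((Finset.Icc t C.n).filter fun v => ¬ C.m.Mem v)
      (fun u hu => ?_) (fun u hu => ?_) (by simp)
    · have hsplit := Finset.card_filter_add_card_filter_not (s := Finset.Icc t C.n) (C.m.Mem)
      rw [Nat.card_Icc] at hsplit
      by_cases hta : t < C.m.a
      · have : Nat.blt t C.m.a = true := by rw [Nat.blt_eq]; exact hta
        rw [this, cond_true] at h1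
        have hsub : (Finset.Icc C.m.a (C.m.a + C.m.L)).card ≤
            ((Finset.Icc t C.n).filter C.m.Mem).card := by
          refine Finset.card_le_card fun u hu => ?_
          rw [Finset.mem_Icc] at hu
          rw [Finset.mem_filter, Finset.mem_Icc]
          exact ⟨by omega, hu⟩
        rw [Nat.card_Icc] at hsub
        omega
      · have : Nat.blt t C.m.a = false := by rw [← Bool.not_eq_true, Nat.blt_eq]; exact hta
        rw [this, cond_false] at h1
        omega
    · rw [List.mem_toFinset, I.mem_stack] at hu
      obtain ⟨_, h3, v, h4, h5⟩ := hu
      exact ⟨by have := h5.lt; have := h5.le; omega, h3⟩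
    · rw [List.mem_toFinset, I.mem_stack] at hu
      obtain ⟨h2, h3, v, h4, h5⟩ := hu
      refine Or.inr ⟨v, ?_, h5.le, h5.eq.symm, by omega⟩
      rw [Finset.mem_filter, Finset.mem_Icc]
      exact ⟨⟨h4, h5.le⟩, h5.not_mem_right H (h3 _ C.main_mem)⟩
  · have hcard := h.card_le (t := t) (B := B) (Finset.Icc (C.m.a + C.m.L + 1) C.n)
      (st.toFinset ∪ Finset.Ico t C.m.a)
      (fun u hu => ?_) (fun u hu => ?_) I.singles
    · have := Finset.card_union_le st.toFinset (Finset.Ico t C.m.a)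
      rw [Nat.card_Ico] at this
      rw [Nat.card_Icc] at hcard
      omega
    · rw [Finset.mem_Icc] at hu
      exact ⟨hu.2, hfree ho u fun hm => by simp only [Run.Mem] at hm; omega⟩
    · rw [Finset.mem_Icc] at hu
      have hf := hfree ho u fun hm => by simp only [Run.Mem] at hm; omega
      rcases h.single_or_chord hf hu.2 with h2 | ⟨v, h2⟩ | ⟨v, h2, h3⟩
      · exact Or.inl ⟨by omega, h2⟩
      · have := I.opener h2 hf (by omega)
        omega
      · have hlt := h2.lt
        refine Or.inr ⟨v, ?_, by omega, h2.eq, by omega⟩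
        have hva : v < C.m.a := by
          by_contra hh
          have := I.opener h2 h3 (by omega)
          omega
        rw [Finset.mem_union, List.mem_toFinset, I.mem_stack, Finset.mem_Ico]
        by_cases hvt : v < t
        · exact Or.inl ⟨hvt, h3, u, by omega, h2⟩
        · exact Or.inr (by omega)
  · have hcard := h.card_le (t := t) (B := B) (st.toFinset ∪ Finset.Ico t C.m.a)
      (Finset.Icc (C.m.a + C.m.L + 1) C.n)
      (fun u hu => ?_) (fun u hu => ?_) I.singles
    · have hd : Disjoint st.toFinset (Finset.Ico t C.m.a) := by
        rw [Finset.disjoint_left]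
        intro u hu hu'
        rw [List.mem_toFinset, I.mem_stack] at hu
        rw [Finset.mem_Ico] at hu'
        omega
      rw [Finset.card_union_of_disjoint hd, Nat.card_Ico, Nat.card_Icc] at hcard
      omega
    · rw [Finset.mem_union, List.mem_toFinset, I.mem_stack, Finset.mem_Ico] at hu
      rcases hu with ⟨h2, h3, _⟩ | hu
      · exact ⟨by omega, h3⟩
      · exact ⟨by omega, hfree ho u fun hm => by simp only [Run.Mem] at hm; omega⟩
    · have hright : ∀ v, IsChord s C.n u v → C.Free u →
          ∃ v ∈ Finset.Icc (C.m.a + C.m.L + 1) C.n, v ≤ C.n ∧ s v = s u ∧ v ≠ u := by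
        intro v h2 hf
        have hlt := h2.lt
        refine ⟨v, ?_, h2.le, h2.eq.symm, by omega⟩
        have h4 := h2.not_mem_right H (hf _ C.main_mem)
        simp only [Run.Mem] at h4
        have h5 := h2.le
        rw [Finset.mem_Icc]
        by_contra hh
        have := I.opener h2 hf (by omega)
        omega
      rw [Finset.mem_union, List.mem_toFinset, I.mem_stack, Finset.mem_Ico] at hu
      rcases hu with ⟨_, h3, v, _, h5⟩ | hu
      · exact Or.inr (hright v h5 h3)
      · have hf := hfree ho u fun hm => by simp only [Run.Mem] at hm; omega
        rcases h.single_or_chord hf (by omega) with h2 | ⟨v, h2⟩ | ⟨v, h2, h3⟩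
        · exact Or.inl ⟨hu.1, h2⟩
        · exact Or.inr (hright v h2 hf)
        · have := I.opener h2 h3 (by omega)
          omega

end Search.Inv

/-- The search does not succeed if there is a walk to be found. -/
theorem Search.IsModel.refute_eq_false (h : C.IsModel s) (f : ℕ) {t B c : ℕ} {st : List ℕ}
    {bl : List (ℕ × ℕ × ℕ)} (I : C.Inv s t st B bl c) : refute C f t st B bl c = false := by
  induction f generalizing t st B bl c with
  | zero => rfl
  | succ f ih =>
    unfold refute
    cases htn : Nat.blt C.n t with
    | true =>
      rw [Nat.blt_eq] at htn
      rw [cond_true]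
      cases st with
      | nil =>
        refine h.not_detour fun p hp => ?_
        obtain ⟨h1, -, -, h2⟩ := I.blocks p hp
        exact ⟨h1.lt.le, h2⟩
      | cons u st =>
        obtain ⟨-, -, v, h1, h2⟩ := I.mem_stack.1 (List.mem_cons_self (a := u) (l := st))
        have := h2.le
        omega
    | false =>
      rw [← Bool.not_eq_true, Nat.blt_eq] at htn
      rw [cond_false]
      cases h0 : Nat.beq (runAt t C.runs) 0 with
      | false =>
        rw [← Bool.not_eq_true, Nat.beq_eq] at h0
        rw [cond_false, forceNat_eq]
        obtain ⟨r, hr, hrt, hrL⟩ := runAt_ne_zero h0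
        rw [hrL]
        exact ih (I.jump h hr hrt)
      | true =>
        rw [Nat.beq_eq] at h0
        have hf := I.free h0
        simp only [cond_true, forceNat_eq]
        rw [I.not_unbalanced h hf, Bool.false_or]
        rcases h.single_or_chord hf (by omega) with h1 | ⟨v, h1⟩ | ⟨i, h1, h2⟩
        · obtain ⟨hB, I'⟩ := I.single (by omega) h0 h1
          have : Nat.beq B 0 = false := by rw [← Bool.not_eq_true, Nat.beq_eq]; exact hB
          rw [this, cond_false, ih I', Bool.and_false]
        · have : (Nat.blt t C.m.a || Nat.blt t c) = true := by
            rw [Bool.or_eq_true, Nat.blt_eq, Nat.blt_eq]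
            by_contra hh
            push Not at hh
            have := I.opener h1 hf (by omega)
            omega
          rw [this, cond_true, ih (I.opens h0 h1), Bool.and_false, Bool.false_and]
        · have hist : i ∈ st := I.mem_stack.2 ⟨h1.lt, h2, t, le_rfl, h1⟩
          have : (Nat.beq c 0 && Nat.blt t C.m.a) = false := by
            rw [← Bool.not_eq_true, Bool.and_eq_true, Nat.beq_eq, Nat.blt_eq]
            rintro ⟨rfl, h3⟩
            have := I.opener h1 h2 (by omega)
            omega
          rw [this, Bool.false_or]
          cases st with
          | nil => simp at hist
          | cons hd st =>
            simp only
            rw [I.not_closings h rfl h1 h2 fun _ _ _ _ _ _ I' => ih I', Bool.false_and,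
              Bool.false_and]

end

/-! ### The runs of a walk with few states -/

section

/-- Whether `f i` holds for all `i < n`. -/
def allLt (n : ℕ) (f : ℕ → Bool) : Bool :=
  match n with
  | 0 => true
  | n + 1 => f n && allLt n f

theorem of_allLt {n : ℕ} {f : ℕ → Bool} (h : allLt n f = true) {i : ℕ} (hi : i < n) :
    f i = true := by
  induction n with
  | zero => omega
  | succ n ih =>
    rw [allLt, Bool.and_eq_true] at h
    rcases Nat.lt_succ_iff_lt_or_eq.1 hi with h1 | rfl
    · exact ih h.2 h1
    · exact h.1

/-- Whether the factor of `w` read during a run has period `r.l`. -/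
def Run.periodic (r : Run) (w : ℕ) : Bool :=
  Nat.beq ((w >>> r.a) % 2 ^ (r.L - r.l)) ((w >>> (r.a + r.l)) % 2 ^ (r.L - r.l))

/-- Whether a search refutes that `r` is the only run. -/
def refuteOne (k n w : ℕ) (r : Run) : Bool :=
  bif Nat.ble (2 * r.l + 1) r.L then
    forceNat (r.L - 1 - 2 * r.l) fun B => forceNat (bif Nat.beq r.l 1 then 0 else n + 1) fun c =>
    refute ⟨w, k, n, r, []⟩ (n + 2) 0 [] B [] c
  else true

/-- Whether searches refute that there are exactly two runs, namely the run `r` and a run of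
period `4`. -/
def refuteTwo (k n w : ℕ) (r : Run) : Bool :=
  bif Nat.beq r.l 3 then
    allLt (n - 7) fun a =>
    bif Run.periodic ⟨a, 4, 8⟩ w && (Nat.blt (r.a + r.L) a || Nat.blt (a + 8) r.a) then
      forceNat (r.L - 6) fun B => forceNat (n + 1) fun c =>
      refute ⟨w, k, n, r, [⟨a, 4, 8⟩]⟩ (n + 2) 0 [] B [] c
    else true
  else true

/-- Whether searches refute all configurations of runs in a walk that reads the word `w`. -/
def refuteWord (k n w : ℕ) : Bool :=
  allLt k fun l => allLt (l + k) fun L => bif Nat.blt 0 l && Nat.ble (2 * l) L then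
    allLt (n + 1 - L) fun a =>
      bif Run.periodic ⟨a, l, L⟩ w then
        refuteOne k n w ⟨a, l, L⟩ && refuteTwo k n w ⟨a, l, L⟩ else true
  else true

section Counting

variable {σ : Type*}

open scoped Classical in
/-- The times at which the state has been visited before and will be visited again. -/
noncomputable def middleTimes (s : ℕ → σ) (n : ℕ) : Finset ℕ :=
  (Finset.range (n + 1)).filter fun t => (∃ u < t, s u = s t) ∧ ∃ v, t < v ∧ v ≤ n ∧ s v = s t

theorem mem_middleTimes {s : ℕ → σ} {n t : ℕ} : t ∈ middleTimes s n ↔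
    t ≤ n ∧ (∃ u < t, s u = s t) ∧ ∃ v, t < v ∧ v ≤ n ∧ s v = s t := by
  simp only [middleTimes, Finset.mem_filter, Finset.mem_range, Nat.lt_succ_iff]

open scoped Classical in
/-- Every state has a first and a last visit; these coincide for states that are visited once, and
only the middle times are neither. -/
theorem card_single_add_le [DecidableEq σ] (s : ℕ → σ) (n : ℕ) :
    ((Finset.range (n + 1)).filter fun t => ∀ v ≤ n, s v = s t → v = t).card + (n + 1) ≤
      2 * ((Finset.range (n + 1)).image s).card + (middleTimes s n).card := by
  set R := Finset.range (n + 1) with hR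
  set Φ := R.filter fun t => ∀ u < t, s u ≠ s t with hΦ
  set Λ := R.filter fun t => ∀ v, t < v → v ≤ n → s v ≠ s t with hΛ
  have h1 : Φ.card ≤ (R.image s).card := by
    refine Finset.card_le_card_of_injOn s (fun t ht => ?_) fun t ht u hu h => ?_
    · exact Finset.mem_coe.2 (Finset.mem_image_of_mem _ (Finset.mem_filter.1 ht).1)
    · have ht' := (Finset.mem_filter.1 (Finset.mem_coe.1 ht)).2
      have hu' := (Finset.mem_filter.1 (Finset.mem_coe.1 hu)).2
      rcases lt_trichotomy t u with h2 | h2 | h2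
      · exact absurd h (hu' t h2)
      · exact h2
      · exact absurd h.symm (ht' u h2)
  have h2 : Λ.card ≤ (R.image s).card := by
    refine Finset.card_le_card_of_injOn s (fun t ht => ?_) fun t ht u hu h => ?_
    · exact Finset.mem_coe.2 (Finset.mem_image_of_mem _ (Finset.mem_filter.1 ht).1)
    · have ht' := Finset.mem_filter.1 (Finset.mem_coe.1 ht)
      have hu' := Finset.mem_filter.1 (Finset.mem_coe.1 hu)
      rw [hR, Finset.mem_range] at ht' hu'
      rcases lt_trichotomy t u with h2 | h2 | h2
      · exact absurd h.symm (ht'.2 u h2 (by omega))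
      · exact h2
      · exact absurd h (hu'.2 t h2 (by omega))
  have h3 : (R.filter fun t => ∀ v ≤ n, s v = s t → v = t).card ≤ (Φ ∩ Λ).card := by
    refine Finset.card_le_card fun t ht => ?_
    rw [Finset.mem_filter, hR, Finset.mem_range] at ht
    rw [Finset.mem_inter, hΦ, hΛ, Finset.mem_filter, Finset.mem_filter, hR, Finset.mem_range]
    refine ⟨⟨ht.1, fun u hu h => ?_⟩, ht.1, fun v hv hvn h => ?_⟩
    · have := ht.2 u (by omega) h
      omega
    · have := ht.2 v hvn h
      omega
  have h4 : R ⊆ (Φ ∪ Λ) ∪ middleTimes s n := by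
    intro t ht
    by_contra hh
    simp only [hΦ, hΛ, middleTimes, Finset.mem_union, Finset.mem_filter, ← hR, ht, true_and] at hh
    push Not at hh
    obtain ⟨⟨⟨u, hu, hus⟩, v, hv, hvn, hvs⟩, h5⟩ := hh
    exact h5 ⟨u, hu, hus⟩ v hv hvn hvs
  have h5 := (Finset.card_le_card h4).trans (Finset.card_union_le _ _)
  have h6 := Finset.card_union_add_card_inter Φ Λ
  rw [hR, Finset.card_range] at h5
  omega

end Counting

section Models

variable {σ : Type*} {s : ℕ → σ} {w k n : ℕ} {r r' : Run}

theorem IsRun.mem_of_eq (hr : IsRun s n r) {t u : ℕ} (ht : r.Mem t) (hu : u ≤ n) (h : s u = s t) :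
    r.Mem u := ((hr.iff ht hu).1 h).1

/-- The middle times of a run belong to the middle part of the run. -/
theorem IsRun.middle (hr : IsRun s n r) {t : ℕ} (ht : r.Mem t) (hm : t ∈ middleTimes s n) :
    t ∈ Finset.Icc (r.a + r.l) (r.a + r.L - r.l) := by
  rw [mem_middleTimes] at hm
  obtain ⟨htn, ⟨u, hut, hu⟩, v, htv, hvn, hv⟩ := hm
  obtain ⟨h1, h2⟩ := (hr.iff ht (by omega)).1 hu
  obtain ⟨h3, h4⟩ := (hr.iff ht hvn).1 hv
  have h5 := Nat.le_of_dvd (by omega) ((Nat.modEq_iff_dvd' hut.le).1 h2)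
  have h6 := Nat.le_of_dvd (by omega) ((Nat.modEq_iff_dvd' htv.le).1 h4.symm)
  simp only [Run.Mem] at h1 h3
  rw [Finset.mem_Icc]
  omega

theorem IsRun.state_add (hr : IsRun s n r) {t : ℕ} (ht : r.a ≤ t) (ht' : t + r.l ≤ r.a + r.L) :
    s (t + r.l) = s t :=
  (hr.iff ⟨ht, by omega⟩ (by have := hr.le; omega)).2 ⟨⟨by omega, ht'⟩, by simp [Nat.ModEq]⟩

theorem IsRun.closed_walk (hr : IsRun s n r) {t : ℕ} (ht : r.Mem t) :
    TraceWalk s n r.l (s t) (s t) := by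
  have h1 := hr.le
  have h2 := hr.two
  simp only [Run.Mem] at ht
  by_cases h : t + r.l ≤ r.a + r.L
  · exact TraceWalk.seg' rfl (by omega) rfl (hr.state_add ht.1 h)
  · have h3 := hr.state_add (t := t - r.l) (by omega) (by omega)
    rw [Nat.sub_add_cancel (by omega)] at h3
    exact TraceWalk.seg' (i := t - r.l) (j := t) (by omega) (by omega) h3.symm rfl

theorem IsRun.dvd_of_mem (hr : IsRun s n r) (hr' : IsRun s n r') {t : ℕ} (ht : r.Mem t)
    (ht' : r'.Mem t) : r'.l ∣ r.l := by
  have h1 := hr.le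
  have h2 := hr.two
  have ht1 := ht
  simp only [Run.Mem] at ht1
  by_cases h : t + r.l ≤ r.a + r.L
  · have h3 := ((hr'.iff ht' (by omega)).1 (hr.state_add ht1.1 h)).2
    simpa using (Nat.modEq_iff_dvd' (Nat.le_add_right t r.l)).1 h3.symm
  · have h3 := hr.state_add (t := t - r.l) (by omega) (by omega)
    rw [Nat.sub_add_cancel (by omega)] at h3
    have h4 := ((hr'.iff ht' (by omega)).1 h3.symm).2
    have := (Nat.modEq_iff_dvd' (Nat.sub_le t r.l)).1 h4
    rwa [Nat.sub_sub_self (by omega)] at this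

theorem IsRun.testBit_add (hr : IsRun s n r) (U : UniqueWalk s w.testBit n) {e : ℕ}
    (he : e < r.L - r.l) : w.testBit (r.a + e) = w.testBit (r.a + r.l + e) := by
  have h1 := hr.le
  refine U.label_eq (by omega) (by omega) ?_ ?_
  · have := hr.state_add (t := r.a + e) (by omega) (by omega)
    rw [← this]; congr 1; omega
  · have := hr.state_add (t := r.a + e + 1) (by omega) (by omega)
    rw [← this]; congr 1; omega

theorem IsRun.periodic (hr : IsRun s n r) (U : UniqueWalk s w.testBit n) :
    r.periodic w = true := by
  rw [Run.periodic, Nat.beq_eq]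
  refine Nat.eq_of_testBit_eq fun e => ?_
  rw [Nat.testBit_mod_two_pow, Nat.testBit_mod_two_pow, Nat.testBit_shiftRight,
    Nat.testBit_shiftRight]
  by_cases he : e < r.L - r.l
  · rw [hr.testBit_add U he]
  · simp [he]

theorem IsRun.lt_add (hr : IsRun s n r) (U : UniqueWalk s w.testBit n)
    (hw : ∀ i j, i < j → j + k ≤ n → ∃ e < k, w.testBit (i + e) ≠ w.testBit (j + e)) :
    r.L < r.l + k := by
  by_contra hh
  have h1 := hr.le
  have h2 := hr.two
  have h3 := hr.pos
  obtain ⟨e, he, hne⟩ := hw r.a (r.a + r.l) (by omega) (by omega)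
  exact hne (hr.testBit_add U (by omega))

/-- A run that does not contain another run has no time in common with it, and a shorter or
longer period. -/
theorem IsRun.disjoint (hr : IsRun s n r) (hr' : IsRun s n r') {x : ℕ → Bool}
    (U : UniqueWalk s x n) {t : ℕ} (hrt : ¬ r.Mem t) (hrt' : r'.Mem t) :
    r.l ≠ r'.l ∧ ∀ u, r.Mem u → ¬ r'.Mem u := by
  have h1 := hr'.le
  have h2 := hr.two_le_turns
  have h3 := hrt'
  simp only [Run.Mem] at h3
  have hne : r.l ≠ r'.l := fun h =>
    hr.no_closed_walk U (by omega) hrt (hr'.closed_walk hrt') (γ := 1) (δ := 1) (by omega) le_rfl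
      (by omega)
  exact ⟨hne, fun u hu hu' => hne (Nat.dvd_antisymm (hr'.dvd_of_mem hr hu' hu)
    (hr.dvd_of_mem hr' hu hu'))⟩

/-- The cycle of another run, if it had length one or two, could be repeated instead of some turns
of the run. -/
theorem IsRun.two_lt (hr : IsRun s n r) (hr' : IsRun s n r') {x : ℕ → Bool}
    (U : UniqueWalk s x n) {t : ℕ} (hrt : ¬ r.Mem t) (hrt' : r'.Mem t) : 2 < r'.l := by
  have h1 := hr'.le
  have h2 := hr.two_le_turns
  have h3 := hrt'
  simp only [Run.Mem] at h3
  by_contra hh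
  exact hr.no_closed_walk U (by omega) hrt (hr'.closed_walk hrt') (mul_comm _ r.l) hr'.pos
    (by omega)

theorem IsRun.three_four (hr : IsRun s n r) (hr' : IsRun s n r') {x : ℕ → Bool}
    (U : UniqueWalk s x n) {t : ℕ} (hrt : ¬ r.Mem t) (hrt' : r'.Mem t) (h4 : r.l ≤ 4)
    (h4' : r'.l ≤ 4) : (r.l = 3 ∧ r'.l = 4) ∨ (r.l = 4 ∧ r'.l = 3) := by
  obtain ⟨h1, h2⟩ := hr.disjoint hr' U hrt hrt'
  have h3 := hr.two_lt hr' U hrt hrt'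
  have h5 := hr'.two_lt hr U (h2 _ hr.mem_start) hr.mem_start
  omega

end Models

open scoped Classical in
theorem Search.Inv.init {σ : Type*} {s : ℕ → σ} {C : Search} {B c : ℕ}
    (hB : ((Finset.range (C.n + 1)).filter fun t => ∀ v ≤ C.n, s v = s t → v = t).card ≤ B)
    (hc : ∀ {i j}, IsChord s C.n i j → C.Free i → ¬ (i < C.m.a ∧ C.m.a < j) → i < c) :
    C.Inv s 0 [] B [] c where
  runs r _ := Or.inl (Nat.zero_le _)
  sorted := List.Pairwise.nil
  mem_stack {u} := by simp
  singles := by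
    refine (Finset.card_le_card fun u hu => ?_).trans hB
    rw [Finset.mem_filter, Finset.mem_Icc] at hu
    rw [Finset.mem_filter, Finset.mem_range]
    exact ⟨by omega, hu.2.2⟩
  blocks := by simp
  opener := hc

/-- If the word `w` passes the test `refuteWord`, then a unique walk of length `n` that reads it
visits at least half as many states. -/
theorem UniqueWalk.le_card_of_refuteWord {σ : Type*} [DecidableEq σ] {s : ℕ → σ} {w k n : ℕ}
    (U : UniqueWalk s w.testBit n) (hk : k ≤ 5)
    (hw : ∀ {i j}, i < j → j + k ≤ n → ∃ e < k, w.testBit (i + e) ≠ w.testBit (j + e))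
    (h : refuteWord k n w = true) : n ≤ 2 * ((Finset.range (n + 1)).image s).card := by
  by_contra hlt
  have hcount := card_single_add_le s n
  have hlen := fun {r} (hr : IsRun s n r) => hr.lt_add U fun i j => hw
  have hl4 : ∀ {r}, IsRun s n r → r.l ≤ 4 := fun {r} hr => by
    have := hlen hr
    have := hr.two
    omega
  have hex : ∀ t ∈ middleTimes s n, ∃ r, IsRun s n r ∧ r.Mem t := by
    intro t ht
    rw [mem_middleTimes] at ht
    obtain ⟨-, ⟨u, hut, hu⟩, v, htv, hvn, hv⟩ := ht
    obtain ⟨r, hr, hru⟩ := U.exists_run hut htv hvn hu hv.symm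
    exact ⟨r, hr, hr.mem_of_eq hru (by omega) hu.symm⟩
  have hperiodic := fun {r} (hr : IsRun s n r) => hr.periodic U
  have hguard : ∀ {r}, IsRun s n r →
      refuteOne k n w r = true ∧ refuteTwo k n w r = true := by
    intro r hr
    have h1 := hlen hr
    have h2 := hr.two
    have h3 := hr.pos
    have h4 := of_allLt (of_allLt h (i := r.l) (by omega)) h1
    rw [show (Nat.blt 0 r.l && Nat.ble (2 * r.l) r.L) = true by
      rw [Bool.and_eq_true, Nat.blt_eq, Nat.ble_eq]; exact ⟨h3, h2⟩, cond_true] at h4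
    have h5 := of_allLt h4 (i := r.a) (by have := hr.le; omega)
    rw [show Run.periodic ⟨r.a, r.l, r.L⟩ w = true from hperiodic hr, cond_true,
      Bool.and_eq_true] at h5
    exact h5
  -- all states off the runs are visited at most twice, once the runs contain all middle times
  have htwice : ∀ {C : Search}, C.n = n → (∀ t ∈ middleTimes s n, ¬ C.Free t) →
      (∀ r ∈ C.runs, IsRun s n r) → ∀ {i j u}, i < j → j < u → u ≤ C.n → s i = s j → s j = s u →
      ¬ C.Free i := by
    intro C hn hC hruns i j u hij hju hu h1 h2 hf
    refine hC j ?_ fun r hr hm => hf r hr ((hruns r hr).mem_of_eq hm (by omega) h1)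
    rw [mem_middleTimes]
    exact ⟨by omega, ⟨i, hij, h1⟩, u, hju, by omega, h2.symm⟩
  -- two runs, of periods three and four
  have htwo : ∀ r r', IsRun s n r → IsRun s n r' → (∀ u, r.Mem u → ¬ r'.Mem u) → r.l = 3 →
      r'.l = 4 → False := by
    intro r r' hr hr' hd h3 h4
    have hd' : r.a + r.L < r'.a ∨ r'.a + r'.L < r.a := by
      by_contra hh
      exact hd (max r.a r'.a) ⟨by omega, by omega⟩ ⟨by omega, by omega⟩
    have hmem : ∀ t ∈ middleTimes s n, r.Mem t ∨ r'.Mem t := by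
      intro t ht
      by_contra hh
      push Not at hh
      obtain ⟨q, hq, hqt⟩ := hex t ht
      have h5 := hr.three_four hq U hh.1 hqt (hl4 hr) (hl4 hq)
      have h6 := hr'.three_four hq U hh.2 hqt (hl4 hr') (hl4 hq)
      omega
    have hL : r'.L = 8 := by
      have := hr'.two
      have := hlen hr'
      omega
    obtain ⟨a, l, L⟩ := r'
    simp only at h4 hL
    subst h4 hL
    have hL3 := hlen hr
    have hle := hr.le
    have hle' := hr'.le
    have hr2 := hr.two
    simp only at hle' hd'
    have h5 := (hguard hr).2
    rw [refuteTwo, h3, show Nat.beq 3 3 = true from rfl, cond_true] at h5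
    have h6 := of_allLt h5 (i := a) (by omega)
    rw [show (Run.periodic ⟨a, 4, 8⟩ w && (Nat.blt (r.a + r.L) a || Nat.blt (a + 8) r.a)) = true by
      rw [Bool.and_eq_true, Bool.or_eq_true, Nat.blt_eq, Nat.blt_eq]
      exact ⟨hperiodic hr', hd'⟩, cond_true, forceNat_eq, forceNat_eq] at h6
    have hruns : ∀ q ∈ [r, ⟨a, 4, 8⟩], IsRun s n q := by
      intro q hq
      simp only [List.mem_cons, List.not_mem_nil, or_false] at hq
      rcases hq with rfl | rfl
      · exact hr
      · exact hr'
    have hM : Search.IsModel ⟨w, k, n, r, [⟨a, 4, 8⟩]⟩ s := by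
      refine ⟨U, hruns, ?_, ?_, hw, by simp⟩
      · intro q hq q' hq' t hqt hqt'
        simp only [Search.runs, List.mem_cons, List.not_mem_nil, or_false] at hq hq'
        rcases hq with rfl | rfl <;> rcases hq' with rfl | rfl
        · rfl
        · exact absurd hqt' (hd t hqt)
        · exact absurd hqt (hd t hqt')
        · rfl
      · refine htwice (C := ⟨w, k, n, r, [⟨a, 4, 8⟩]⟩) rfl (fun t ht hf => ?_) hruns
        rcases hmem t ht with h7 | h7
        · exact hf _ (by simp [Search.runs]) h7
        · exact hf ⟨a, 4, 8⟩ (by simp [Search.runs]) h7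
    have hmid : middleTimes s n ⊆ Finset.Icc (r.a + r.l) (r.a + r.L - r.l) ∪
        Finset.Icc (a + 4) (a + 8 - 4) := by
      intro t ht
      rw [Finset.mem_union]
      exact (hmem t ht).imp (fun h => hr.middle h ht) fun h => hr'.middle h ht
    have hcard := (Finset.card_le_card hmid).trans (Finset.card_union_le _ _)
    rw [Nat.card_Icc, Nat.card_Icc] at hcard
    rw [hM.refute_eq_false _ (Search.Inv.init (by simp only; omega) fun {i j} hc _ _ => by
      have := hc.lt; have := hc.le; simp only at this; omega)] at h6
    exact absurd h6 (by simp)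
  -- the other case: a single run
  obtain ⟨t₀, ht₀⟩ : (middleTimes s n).Nonempty := by
    rw [← Finset.card_pos]; omega
  obtain ⟨r, hr, -⟩ := hex t₀ ht₀
  have hmem : ∀ t ∈ middleTimes s n, r.Mem t := by
    intro t ht
    by_contra hh
    obtain ⟨q, hq, hqt⟩ := hex t ht
    have hd := (hr.disjoint hq U hh hqt).2
    rcases hr.three_four hq U hh hqt (hl4 hr) (hl4 hq) with ⟨h1, h2⟩ | ⟨h1, h2⟩
    · exact htwo r q hr hq hd h1 h2
    · exact htwo q r hq hr (fun u h h' => hd u h' h) h2 h1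
  have hcard := Finset.card_le_card fun t ht => hr.middle (hmem t ht) ht
  rw [Nat.card_Icc] at hcard
  have hL := hlen hr
  have hpos := hr.pos
  have htwo := hr.two
  have hM : Search.IsModel ⟨w, k, n, r, []⟩ s := by
    have hruns : ∀ q ∈ [r], IsRun s n q := by simpa using hr
    refine ⟨U, hruns, ?_, ?_, hw, fun _ => by simp only; omega⟩
    · intro q hq q' hq' _ _ _
      simp only [Search.runs, List.mem_singleton] at hq hq'
      rw [hq, hq']
    · exact htwice (C := ⟨w, k, n, r, []⟩) rfl
        (fun t ht hf => hf r (by simp [Search.runs]) (hmem t ht)) hruns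
  have h5 := (hguard hr).1
  rw [refuteOne, show Nat.ble (2 * r.l + 1) r.L = true by rw [Nat.ble_eq]; omega, cond_true,
    forceNat_eq, forceNat_eq, hM.refute_eq_false _ (Search.Inv.init (by simp only; omega) ?_)] at h5
  · exact absurd h5 (by simp)
  · intro i j hc hi hne
    have h6 := hc.not_dvd hr U (hi r (by simp [Search.runs])) hne
    have h7 : Nat.beq r.l 1 = false := by
      rw [← Bool.not_eq_true, Nat.beq_eq]
      intro h8
      rw [h8] at h6
      exact h6 (one_dvd _)
    rw [h7, cond_false]
    have := hc.lt
    have := hc.le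
    simp only at this
    omega

end

/-! ### Words produced by linear registers -/

section

/-- The parity of the number of ones among the first `k` binary digits of `a`. -/
def parity : ℕ → ℕ → ℕ
  | 0, _ => 0
  | k + 1, a => (a + parity k (a >>> 1)) % 2

/-- The successor of the state `v` (whose `i`-th digit is the content of the `i`-th cell) in the
`k`-stage linear register with coefficients given by the digits of `c`. -/
def nextState (k c v : ℕ) : ℕ := (v >>> 1) ||| (parity k (Nat.land c v) <<< (k - 1))

/-- The test `g` of the word of length `n` that is produced from a given state, if the first `n`
states are distinct. The remaining arguments are: the number of digits still to be produced, the
present state, the set of the states met so far, and the digits found so far. -/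
def testWord (k c n : ℕ) (g : ℕ → Bool) : ℕ → ℕ → ℕ → ℕ → Bool
  | 0, _, _, w => g w
  | m + 1, v, seen, w =>
    bif Nat.testBit seen v then true else
    forceNat (nextState k c v) fun v' => forceNat (seen ||| 2 ^ v) fun seen' =>
    forceNat (w ||| (v % 2) <<< (n - (m + 1))) fun w' => testWord k c n g m v' seen' w'

/-- The test of the words produced by the register with coefficients `c`, from all states. -/
def testCoeff (k c : ℕ) : Bool :=
  forceNat (2 ^ k - 1) fun n => allLt (n + 1) fun v => testWord k c n (refuteWord k n) n v 0 0

end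

section

theorem parity_lt_two (k a : ℕ) : parity k a < 2 := by
  cases k with
  | zero => simp [parity]
  | succ k => exact Nat.mod_lt _ two_pos

theorem cast_parity (k a : ℕ) :
    (parity k a : ZMod 2) = ∑ i ∈ Finset.range k, if a.testBit i then 1 else 0 := by
  induction k generalizing a with
  | zero => simp [parity]
  | succ k ih =>
    rw [parity, ZMod.natCast_mod, Nat.cast_add, ih, Finset.sum_range_succ', add_comm]
    congr 1
    · refine Finset.sum_congr rfl fun i _ => ?_
      rw [Nat.testBit_shiftRight, add_comm]
    · rw [← ZMod.natCast_mod, Nat.testBit_zero]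
      rcases Nat.mod_two_eq_zero_or_one a with h | h <;> simp [h]

theorem testBit_parity (k a i : ℕ) :
    (parity k a).testBit i = (decide (i = 0) && decide ((parity k a : ZMod 2) = 1)) := by
  have h := parity_lt_two k a
  interval_cases parity k a
  · simp
  · cases i <;> simp [Nat.testBit_succ]

/-- The number whose binary digits are the `k` digits of `y` from time `t` on. -/
def stateNum (k : ℕ) (y : ℕ → ZMod 2) (t : ℕ) : ℕ :=
  Nat.ofBits fun i : Fin k => decide (y (t + i) = 1)

theorem testBit_stateNum (k : ℕ) (y : ℕ → ZMod 2) (t i : ℕ) :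
    (stateNum k y t).testBit i = (decide (i < k) && decide (y (t + i) = 1)) := by
  by_cases h : i < k
  · simp [stateNum, Nat.testBit_ofBits_lt _ _ h, h]
  · simp [stateNum, Nat.testBit_ofBits_ge _ _ (not_lt.1 h), h]

theorem stateNum_succ {k : ℕ} (hk : 0 < k) (F : (Fin k → ZMod 2) →ₗ[ZMod 2] ZMod 2) {y : ℕ → ZMod 2}
    {t : ℕ} (h : y (t + k) = F fun i => y (t + i)) :
    stateNum k y (t + 1) =
      nextState k (Nat.ofBits fun i : Fin k => decide (F (fun j => if i = j then 1 else 0) = 1))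
        (stateNum k y t) := by
  have hp : (parity k (Nat.land
      (Nat.ofBits fun i : Fin k => decide (F (fun j => if i = j then 1 else 0) = 1))
      (stateNum k y t)) : ZMod 2) = y (t + k) := by
    have h01 : ∀ a b : ZMod 2, (if decide (a = 1) && decide (b = 1) then 1 else 0) = b * a := by
      decide
    rw [cast_parity, h, LinearMap.pi_apply_eq_sum_univ F, Finset.sum_range]
    refine Finset.sum_congr rfl fun i _ => ?_
    rw [smul_eq_mul, ← h01]
    have hl : ∀ a b i, (Nat.land a b).testBit i = (a.testBit i && b.testBit i) := Nat.testBit_and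
    rw [hl, testBit_stateNum, Nat.testBit_ofBits_lt _ _ i.2, decide_eq_true i.2,
      Bool.true_and]
  refine Nat.eq_of_testBit_eq fun i => ?_
  rw [nextState, Nat.testBit_or, Nat.testBit_shiftRight, Nat.testBit_shiftLeft, testBit_parity, hp,
    testBit_stateNum, testBit_stateNum]
  rcases lt_trichotomy (i + 1) k with h1 | h1 | h1
  · simp [show i < k by omega, show 1 + i < k by omega, show ¬ k - 1 ≤ i by omega]
    ring_nf
  · have h2 : t + 1 + i = t + k := by omega
    rw [h2]
    simp [show i < k by omega, show ¬ 1 + i < k by omega, show k - 1 ≤ i by omega,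
      show i - (k - 1) = 0 by omega]
  · simp [show ¬ i < k by omega, show ¬ 1 + i < k by omega, show i - (k - 1) ≠ 0 by omega]

theorem of_testWord {k c n : ℕ} {g : ℕ → Bool} {y : ℕ → ZMod 2} (hk : 0 < k)
    (hnext : ∀ t, stateNum k y (t + 1) = nextState k c (stateNum k y t))
    (hinj : ∀ i j, i < j → j < n → stateNum k y i ≠ stateNum k y j) (m seen w : ℕ) (hm : m ≤ n)
    (hseen : ∀ u, seen.testBit u = true → ∃ t < n - m, u = stateNum k y t)
    (hw : ∀ i, w.testBit i = (decide (i < n - m) && decide (y i = 1)))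
    (h : testWord k c n g m (stateNum k y (n - m)) seen w = true) :
    ∃ w, g w = true ∧ ∀ i, w.testBit i = (decide (i < n) && decide (y i = 1)) := by
  induction m generalizing seen w with
  | zero => exact ⟨w, h, by simpa using hw⟩
  | succ m ih =>
    have hn : seen.testBit (stateNum k y (n - (m + 1))) = false := by
      rw [← Bool.not_eq_true]
      intro hs
      obtain ⟨t, ht, he⟩ := hseen _ hs
      exact hinj t _ ht (by omega) he.symm
    have h1 : n - m = n - (m + 1) + 1 := by omega
    rw [testWord, hn, cond_false, forceNat_eq, forceNat_eq, forceNat_eq, ← hnext, ← h1] at h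
    refine ih _ _ (by omega) (fun u hu => ?_) (fun i => ?_) h
    · rw [Nat.testBit_or, Bool.or_eq_true, Nat.testBit_two_pow, decide_eq_true_eq] at hu
      rcases hu with hu | hu
      · obtain ⟨t, ht, he⟩ := hseen u hu
        exact ⟨t, by omega, he⟩
      · exact ⟨n - (m + 1), by omega, hu.symm⟩
    · have h2 : ∀ j, (stateNum k y (n - (m + 1)) % 2).testBit j =
          (decide (j = 0) && decide (y (n - (m + 1)) = 1)) := by
        intro j
        have := Nat.testBit_mod_two_pow (stateNum k y (n - (m + 1))) 1 j
        rw [pow_one] at this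
        rw [this, testBit_stateNum]
        rcases Nat.eq_zero_or_pos j with rfl | hj
        · simp [hk]
        · simp [show ¬ j < 1 by omega, show j ≠ 0 by omega]
      rw [Nat.testBit_or, hw, Nat.testBit_shiftLeft, h2]
      rcases lt_trichotomy i (n - (m + 1)) with h3 | h3 | h3
      · simp [h3, show i < n - m by omega, show ¬ n - (m + 1) ≤ i by omega]
      · subst h3
        simp [show n - (m + 1) < n - m by omega]
      · simp [show ¬ i < n - (m + 1) by omega, show ¬ i < n - m by omega,
          show i - (n - (m + 1)) ≠ 0 by omega]

/-- The states of a `k`-stage linear register with output `y`, as numbers: they are produced by the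
register whose coefficients are the digits of `c`, and do not recur within `2 ^ k - 1` steps. -/
structure IsMSequence.Spec (k : ℕ) (y : ℕ → ZMod 2) (c : ℕ) : Prop where
  pos : 0 < k
  lt : c < 2 ^ k
  next : ∀ t, stateNum k y (t + 1) = nextState k c (stateNum k y t)
  ne : ∀ i j, i < j → j - i < 2 ^ k - 1 → stateNum k y i ≠ stateNum k y j

theorem stateNum_ne_iff {k : ℕ} {y : ℕ → ZMod 2} {i j : ℕ} (h : stateNum k y i ≠ stateNum k y j) :
    ∃ e < k, y (i + e) ≠ y (j + e) := by
  by_contra hh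
  push Not at hh
  refine h (Nat.eq_of_testBit_eq fun e => ?_)
  rw [testBit_stateNum, testBit_stateNum]
  by_cases he : e < k
  · rw [hh e he]
  · simp [he]

theorem shiftRegister_apply_last {α : Type*} {k : ℕ} (F : (Fin k → α) → α) (v : Fin k → α)
    (i : Fin k) (h : (i : ℕ) + 1 = k) : shiftRegister F v i = F v := by
  rw [shiftRegister, dif_neg (by omega)]

theorem IsMSequence.exists_spec {k : ℕ} {x : List (ZMod 2)} (h : IsMSequence k x) :
    ∃ y c, x = List.ofFn (fun i : Fin (2 ^ k - 1) => y i) ∧ IsMSequence.Spec k y c := by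
  obtain ⟨F, y, hy, hper, rfl⟩ := h
  have hk : 0 < k := by
    rcases Nat.eq_zero_or_pos k with rfl | h
    · have := hper.1.1
      simp at this
    · exact h
  refine ⟨y, _, rfl, hk, Nat.ofBits_lt_two_pow _, fun t => stateNum_succ hk F ?_,
    fun i j hij hlt heq => ?_⟩
  · have h1 := congrFun (hy (t + 1)) ⟨k - 1, by omega⟩
    rw [Function.iterate_succ_apply', hy t, shiftRegister_apply_last _ _ _ (by simp only; omega)]
      at h1
    rw [h1]
    simp only
    congr 1
    omega
  · have hst : (fun e : Fin k => y (i + e)) = fun e : Fin k => y (j + e) := by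
      funext e
      have h1 : ∀ a b : ZMod 2, decide (a = 1) = decide (b = 1) → a = b := by decide
      apply h1
      have := congrArg (Nat.testBit · e) heq
      simpa [testBit_stateNum] using this
    refine absurd (hper.2 ⟨by omega, i, fun t ht => ?_⟩ : 2 ^ k - 1 ≤ j - i) (by omega)
    · simp only
      have h2 : t + (j - i) = (t - i) + j := by omega
      have h3 : t = (t - i) + i := by omega
      conv_rhs => rw [h3]
      rw [h2, Function.iterate_add_apply, Function.iterate_add_apply, hy j, hy i, hst]

end

/-! ### Evaluation of the search -/

section

set_option maxRecDepth 100000 in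
theorem testCoeff_of_lt_five :
    allLt 5 (fun k => forceNat (2 ^ k) fun m => allLt m (testCoeff k)) = true := by
  decide +kernel

/-! The six primitive feedback polynomials of degree five, which account for nearly all of the
evaluation, are treated one at a time to limit the memory it needs. -/

set_option maxRecDepth 100000 in
theorem testCoeff_five_five : testCoeff 5 5 = true := by decide +kernel

set_option maxRecDepth 100000 in
theorem testCoeff_five_nine : testCoeff 5 9 = true := by decide +kernel

set_option maxRecDepth 100000 in
theorem testCoeff_five_fifteen : testCoeff 5 15 = true := by decide +kernel

set_option maxRecDepth 100000 in
theorem testCoeff_five_twentyThree : testCoeff 5 23 = true := by decide +kernel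

set_option maxRecDepth 100000 in
theorem testCoeff_five_twentySeven : testCoeff 5 27 = true := by decide +kernel

set_option maxRecDepth 100000 in
theorem testCoeff_five_twentyNine : testCoeff 5 29 = true := by decide +kernel

set_option maxRecDepth 100000 in
theorem testCoeff_five_of_not_mem :
    allLt 32 (fun c => [5, 9, 15, 23, 27, 29].elem c || testCoeff 5 c) = true := by
  decide +kernel

theorem testCoeff_eq_true {k c : ℕ} (hk : k ≤ 5) (hc : c < 2 ^ k) : testCoeff k c = true := by
  rcases lt_or_eq_of_le hk with h | rfl
  · have := of_allLt testCoeff_of_lt_five h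
    rw [forceNat_eq] at this
    exact of_allLt this hc
  · have := of_allLt testCoeff_five_of_not_mem hc
    rw [Bool.or_eq_true, List.elem_iff] at this
    rcases this with h | h
    · simp only [List.mem_cons, List.not_mem_nil, or_false] at h
      rcases h with rfl | rfl | rfl | rfl | rfl | rfl
      · exact testCoeff_five_five
      · exact testCoeff_five_nine
      · exact testCoeff_five_fifteen
      · exact testCoeff_five_twentyThree
      · exact testCoeff_five_twentySeven
      · exact testCoeff_five_twentyNine
    · exact h

/-- A unique walk that reads an `m`-sequence of length `n` visits at least half as many states. -/
theorem IsMSequence.Spec.le_card {k c : ℕ} {y : ℕ → ZMod 2} (h : IsMSequence.Spec k y c)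
    (hk : k ≤ 5) {σ : Type*} [DecidableEq σ] {s : ℕ → σ} (U : UniqueWalk s y (2 ^ k - 1)) :
    2 ^ k - 1 ≤ 2 * ((Finset.range (2 ^ k - 1 + 1)).image s).card := by
  have h1 := testCoeff_eq_true hk h.lt
  have hpow := Nat.one_lt_two_pow h.pos.ne'
  have hlt : stateNum k y 0 < 2 ^ k := Nat.ofBits_lt_two_pow _
  rw [testCoeff, forceNat_eq] at h1
  have h2 := of_allLt h1 (show stateNum k y 0 < 2 ^ k - 1 + 1 by omega)
  generalize hn : 2 ^ k - 1 = n at *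
  obtain ⟨w, hw, hbit⟩ := of_testWord h.pos h.next (fun i j hij hj => h.ne i j hij (by omega)) n 0 0
    le_rfl (by simp) (by simp) (by simpa using h2)
  refine UniqueWalk.le_card_of_refuteWord (w := w) (k := k) ⟨U.eq_of_walk, ?_⟩ hk ?_ hw
  · intro i j hi hj h3 h4
    rw [hbit, hbit, U.label_eq hi hj h3 h4]
    simp [hi, hj]
  · intro i j hij hj
    have hkn : k ≠ 0 := h.pos.ne'
    obtain ⟨e, he, hne⟩ := stateNum_ne_iff (h.ne i j hij (by omega))
    refine ⟨e, he, ?_⟩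
    rw [hbit, hbit]
    have h01 : ∀ a b : ZMod 2, decide (a = 1) = decide (b = 1) → a = b := by decide
    intro h3
    refine hne (h01 _ _ ?_)
    simpa [show i + e < n by omega, show j + e < n by omega] using h3

end

/-! ### Automata and walks -/

section

namespace NFA

variable {α σ : Type*} {M : NFA α σ}

/-- The state of a path at time `i`, and its last state from then on. -/
def Path.stateAt : {s t : σ} → {x : List α} → M.Path s t x → ℕ → σ
  | _, _, _, .nil s => fun _ => s
  | _, _, _, .cons _ s _ _ _ _ p => fun i => Nat.casesOn i s p.stateAt

theorem Path.stateAt_zero {s t : σ} {x : List α} (p : M.Path s t x) : p.stateAt 0 = s := by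
  cases p <;> rfl

theorem Path.stateAt_length {s t : σ} {x : List α} (p : M.Path s t x) :
    p.stateAt x.length = t := by
  induction p with
  | nil => rfl
  | cons t s u a x h p ih => exact ih

theorem Path.stateAt_succ_mem {s t : σ} {x : List α} (p : M.Path s t x) (i : ℕ)
    (hi : i < x.length) : p.stateAt (i + 1) ∈ M.step (p.stateAt i) x[i] := by
  induction p generalizing i with
  | nil => simp at hi
  | cons t s u a x h p ih =>
    cases i with
    | zero =>
      change p.stateAt 0 ∈ M.step s a
      rwa [p.stateAt_zero]
    | succ i => exact ih i (by simpa using hi)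

theorem Path.ext_stateAt {s t : σ} {x : List α} (p p' : M.Path s t x)
    (h : ∀ i ≤ x.length, p.stateAt i = p'.stateAt i) : p = p' := by
  induction p with
  | nil => cases p'; rfl
  | cons t s u a x hs p ih =>
    cases p' with
    | cons t' _ _ _ _ hs' p' =>
      have h1 : t = t' := by
        have : p.stateAt 0 = p'.stateAt 0 := h 1 (by simp)
        rwa [p.stateAt_zero, p'.stateAt_zero] at this
      subst h1
      rw [ih p' fun i hi => h (i + 1) (by simpa using hi)]

/-- A sequence of states and labels that follows the transitions is a path. -/
theorem exists_path {n : ℕ} (f : ℕ → σ) (w : ℕ → α)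
    (h : ∀ i < n, f (i + 1) ∈ M.step (f i) (w i)) :
    ∃ (x : List α) (p : M.Path (f 0) (f n) x), x.length = n ∧ (∀ i ≤ n, p.stateAt i = f i) ∧
      ∀ i < n, x[i]? = some (w i) := by
  induction n generalizing f w with
  | zero =>
    refine ⟨[], .nil _, rfl, fun i hi => ?_, by simp⟩
    obtain rfl : i = 0 := by omega
    rfl
  | succ n ih =>
    obtain ⟨x, p, h1, h2, h3⟩ := ih (fun i => f (i + 1)) (fun i => w (i + 1))
      fun i hi => h (i + 1) (by omega)
    refine ⟨w 0 :: x, .cons _ _ _ _ _ (h 0 (by omega)) p, by simpa using h1, fun i hi => ?_,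
      fun i hi => ?_⟩
    · cases i with
      | zero => rfl
      | succ i => exact h2 i (by omega)
    · cases i with
      | zero => rfl
      | succ i => simpa using h3 i (by omega)

end NFA

section UniquelyAccepts

variable {α σ : Type*} {M : NFA α σ} {x : List α}

/-- Accepted sequences of states and labels are determined by their length, if there is only one
accepting path. -/
theorem eq_of_subsingleton {n : ℕ} [Subsingleton (AcceptingPath M n)] {f f' : ℕ → σ} {w w' : ℕ → α}
    (h : ∀ i < n, f (i + 1) ∈ M.step (f i) (w i)) (h0 : f 0 ∈ M.start) (hn : f n ∈ M.accept)
    (h' : ∀ i < n, f' (i + 1) ∈ M.step (f' i) (w' i)) (h0' : f' 0 ∈ M.start)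
    (hn' : f' n ∈ M.accept) : (∀ i ≤ n, f i = f' i) ∧ ∀ i < n, w i = w' i := by
  obtain ⟨x, p, h1, h2, h3⟩ := NFA.exists_path f w h
  obtain ⟨x', p', h1', h2', h3'⟩ := NFA.exists_path f' w' h'
  have heq : (⟨_, _, x, p, h0, hn, h1⟩ : AcceptingPath M n) = ⟨_, _, x', p', h0', hn', h1'⟩ :=
    Subsingleton.elim _ _
  have hs : p.stateAt = p'.stateAt := congrArg (fun P : AcceptingPath M n => P.path.stateAt) heq
  have hx : x = x' := congrArg AcceptingPath.word heq
  refine ⟨fun i hi => by rw [← h2 i hi, ← h2' i hi, hs], fun i hi => ?_⟩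
  have h4 := h3 i hi
  rw [hx, h3' i hi] at h4
  exact (Option.some.inj h4).symm

theorem TraceWalk.exists_seq {s : ℕ → σ} {n m : ℕ} {p q : σ} (h : TraceWalk s n m p q) :
    ∃ f : ℕ → σ, f 0 = p ∧ f m = q ∧ ∀ i < m, TraceStep s n (f i) (f (i + 1)) := by
  induction m generalizing p with
  | zero => exact ⟨fun _ => p, rfl, h, by simp⟩
  | succ m ih =>
    obtain ⟨r, h1, h2⟩ := h
    obtain ⟨f, hf0, hfm, hf⟩ := ih h2
    refine ⟨fun i => Nat.casesOn i p f, rfl, hfm, fun i hi => ?_⟩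
    cases i with
    | zero =>
      change TraceStep s n p (f 0)
      rwa [hf0]
    | succ i => exact hf i (by omega)

/-- The only accepting path of an automaton is a unique walk. -/
theorem uniqueWalk_of_subsingleton {n : ℕ} [Subsingleton (AcceptingPath M n)] {s : ℕ → σ}
    {y : ℕ → α} (h : ∀ i < n, s (i + 1) ∈ M.step (s i) (y i)) (h0 : s 0 ∈ M.start)
    (hn : s n ∈ M.accept) : UniqueWalk s y n where
  eq_of_walk {a b r} hab ha hb := by
    obtain ⟨f, hf0, hfa, hf⟩ := ha.exists_seq
    obtain ⟨g, hg0, hgb, hg⟩ := hb.exists_seq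
    set q : ℕ → σ := fun i => if i ≤ a then f i else g (i - a) with hq
    have hq1 : ∀ i ≤ a, q i = f i := fun i hi => if_pos hi
    have hq2 : ∀ i, a ≤ i → q i = g (i - a) := by
      intro i hi
      rcases eq_or_lt_of_le hi with rfl | hi
      · rw [hq1 a le_rfl, hfa, Nat.sub_self, hg0]
      · exact if_neg (by omega)
    have hstep : ∀ i < n, ∃ c, q (i + 1) ∈ M.step (q i) c := by
      have aux : ∀ p p', TraceStep s n p p' → ∃ c, p' ∈ M.step p c := by
        rintro p p' ⟨t, ht, rfl, rfl⟩
        exact ⟨_, h t ht⟩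
      intro i hi
      rcases lt_or_ge i a with h1 | h1
      · rw [hq1 i h1.le, hq1 (i + 1) h1]
        exact aux _ _ (hf i h1)
      · rw [hq2 i h1, hq2 (i + 1) (by omega), Nat.sub_add_comm h1]
        exact aux _ _ (hg (i - a) (by omega))
    have : Nonempty α := ⟨y 0⟩
    choose! w hw using hstep
    have := (eq_of_subsingleton h h0 hn hw (by rwa [hq1 0 (by omega), hf0])
      (by rwa [hq2 n (by omega), show n - a = b by omega, hgb])).1 a (by omega)
    rw [this, hq1 a le_rfl, hfa]
  label_eq {i j} hi hj h1 h2 := by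
    classical
    have := (eq_of_subsingleton (w' := Function.update y i (y j)) h h0 hn (fun t ht => ?_) h0 hn).2
      i hi
    · simpa using this
    · by_cases hti : t = i
      · subst hti
        rw [Function.update_self, h1, h2]
        exact h j hj
      · rw [Function.update_of_ne hti]
        exact h t ht

theorem UniquelyAccepts.exists_uniqueWalk (h : UniquelyAccepts M x) {y : ℕ → α}
    (hy : ∀ i (hi : i < x.length), x[i] = y i) : ∃ s : ℕ → σ, UniqueWalk s y x.length := by
  obtain ⟨s, hs, t, ht, ⟨p⟩⟩ := NFA.accepts_iff_exists_path.1 h.1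
  have := h.2
  refine ⟨p.stateAt, uniqueWalk_of_subsingleton (M := M) (fun i hi => ?_) ?_ ?_⟩
  · rw [← hy i hi]
    exact p.stateAt_succ_mem i hi
  · rwa [p.stateAt_zero]
  · rwa [p.stateAt_length]

end UniquelyAccepts

section Folded

variable {α : Type*}

/-- The automaton with states `0, …, m` on which a word `y` of length `2 * m + 1` is read along
the path `0, 1, …, m, m, …, 1, 0`. -/
def foldedNFA (m : ℕ) (y : ℕ → α) : NFA α (Fin (m + 1)) where
  step p a := {q | ∃ i < 2 * m + 1, min i (2 * m + 1 - i) = p ∧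
    min (i + 1) (2 * m + 1 - (i + 1)) = q ∧ y i = a}
  start := {0}
  accept := {0}

/-- The only way to return to `0` after `2 * m + 1` steps is to use the loop at `m`, which is
possible only in the middle. -/
theorem foldedNFA_path {m : ℕ} {y : ℕ → α} {f : ℕ → Fin (m + 1)} {w : ℕ → α}
    (h : ∀ i < 2 * m + 1, f (i + 1) ∈ (foldedNFA m y).step (f i) (w i)) (h0 : f 0 = 0)
    (hn : f (2 * m + 1) = 0) :
    (∀ i ≤ 2 * m + 1, (f i : ℕ) = min i (2 * m + 1 - i)) ∧ ∀ i < 2 * m + 1, w i = y i := by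
  have h0' : (f 0 : ℕ) = 0 := by rw [h0]; rfl
  have hn' : (f (2 * m + 1) : ℕ) = 0 := by rw [hn]; rfl
  have hle : ∀ i, (f i : ℕ) ≤ m := fun i => Nat.lt_succ_iff.1 (f i).2
  have hstep : ∀ i < 2 * m + 1, (f (i + 1) : ℕ) = f i + 1 ∨ (f i : ℕ) = f (i + 1) + 1 ∨
      ((f i : ℕ) = m ∧ (f (i + 1) : ℕ) = m) := by
    intro i hi
    obtain ⟨j, hj, h1, h2, -⟩ := h i hi
    omega
  obtain ⟨g, hgf⟩ : ∃ g : ℕ → ℕ, ∀ i, (f i : ℕ) = g i := ⟨_, fun _ => rfl⟩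
  simp only [hgf] at h0' hn' hle hstep ⊢
  have hup : ∀ i ≤ 2 * m + 1, g i ≤ i := by
    intro i
    induction i with
    | zero => omega
    | succ i ih =>
      intro hi
      have := hstep i (by omega)
      have := ih (by omega)
      have := hle i
      omega
  have hdown : ∀ d ≤ 2 * m + 1, g (2 * m + 1 - d) ≤ d := by
    intro d
    induction d with
    | zero => intro _; simp only [Nat.sub_zero]; omega
    | succ d ih =>
      intro hd
      have h1 := hstep (2 * m + 1 - (d + 1)) (by omega)
      have h2 := ih (by omega)
      rw [show 2 * m + 1 - (d + 1) + 1 = 2 * m + 1 - d by omega] at h1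
      omega
  have hloop : g m = m ∧ g (m + 1) = m := by
    by_contra hno
    have hpar : ∀ i ≤ 2 * m + 1, (g i + i) % 2 = 0 := by
      intro i
      induction i with
      | zero => omega
      | succ i ih =>
        intro hi
        have h1 := ih (by omega)
        rcases hstep i (by omega) with h2 | h2 | ⟨h2, h3⟩
        · omega
        · omega
        · have h4 := hup i (by omega)
          have h5 := hdown (2 * m + 1 - (i + 1)) (by omega)
          rw [show 2 * m + 1 - (2 * m + 1 - (i + 1)) = i + 1 by omega] at h5
          obtain rfl : i = m := by omega
          exact absurd ⟨h2, h3⟩ hno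
    have := hpar (2 * m + 1) le_rfl
    omega
  have hleft : ∀ d ≤ m, m ≤ g (m - d) + d := by
    intro d
    induction d with
    | zero => intro _; simp only [Nat.sub_zero]; omega
    | succ d ih =>
      intro hd
      have h1 := hstep (m - (d + 1)) (by omega)
      have h2 := ih (by omega)
      rw [show m - (d + 1) + 1 = m - d by omega] at h1
      omega
  have hright : ∀ d ≤ m, m ≤ g (m + 1 + d) + d := by
    intro d
    induction d with
    | zero => intro _; simp only [Nat.add_zero]; omega
    | succ d ih =>
      intro hd
      have h1 := hstep (m + 1 + d) (by omega)
      have h2 := ih (by omega)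
      rw [show m + 1 + (d + 1) = m + 1 + d + 1 by omega]
      omega
  have hpos : ∀ i ≤ 2 * m + 1, g i = min i (2 * m + 1 - i) := by
    intro i hi
    rcases le_or_gt i m with h1 | h1
    · have h2 := hup i hi
      have h3 := hleft (m - i) (by omega)
      rw [show m - (m - i) = i by omega] at h3
      omega
    · have h2 := hdown (2 * m + 1 - i) (by omega)
      have h3 := hright (i - (m + 1)) (by omega)
      rw [show 2 * m + 1 - (2 * m + 1 - i) = i by omega] at h2
      rw [show m + 1 + (i - (m + 1)) = i by omega] at h3
      omega
  refine ⟨hpos, fun i hi => ?_⟩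
  obtain ⟨j, hj, h1, h2, h3⟩ := h i hi
  rw [hgf, hpos i (by omega)] at h1
  rw [hgf, hpos (i + 1) (by omega)] at h2
  obtain rfl : j = i := by omega
  exact h3.symm

theorem foldedNFA_uniquelyAccepts {m : ℕ} {x : List α} {y : ℕ → α} (hx : x.length = 2 * m + 1)
    (hy : ∀ i (hi : i < x.length), x[i] = y i) : UniquelyAccepts (foldedNFA m y) x := by
  constructor
  · obtain ⟨x', p, h1, -, h3⟩ := NFA.exists_path (M := foldedNFA m y) (n := 2 * m + 1)
      (fun i => ⟨min i (2 * m + 1 - i), by omega⟩) y fun i hi => ⟨i, hi, rfl, rfl, rfl⟩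
    obtain rfl : x' = x := by
      refine List.ext_getElem (by rw [h1, hx]) fun i hi hi' => ?_
      have := h3 i (by omega)
      rw [List.getElem?_eq_getElem hi] at this
      rw [Option.some.inj this, hy]
    refine NFA.accepts_iff_exists_path.2 ⟨_, ?_, _, ?_, ⟨p⟩⟩
    · exact Set.mem_singleton_iff.2 (Fin.ext (by simp))
    · exact Set.mem_singleton_iff.2 (Fin.ext (by simp))
  · rw [hx]
    refine ⟨fun P Q => ?_⟩
    have key : ∀ P : AcceptingPath (foldedNFA m y) (2 * m + 1),
        (∀ i ≤ 2 * m + 1, (P.path.stateAt i : ℕ) = min i (2 * m + 1 - i)) ∧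
          ∀ i (hi : i < P.word.length), P.word[i] = y i := by
      rintro ⟨s, t, w, p, hs, ht, hw⟩
      have := foldedNFA_path (m := m) (y := y) (f := p.stateAt)
        (w := fun i => if h : i < w.length then w[i] else y i) (fun i hi => ?_) ?_ ?_
      · refine ⟨this.1, fun i hi => ?_⟩
        have h1 := this.2 i (by simp only at hi; omega)
        simp only at hi
        simpa [hi] using h1
      · simp only [show i < w.length by omega, dif_pos]
        exact p.stateAt_succ_mem i (by omega)
      · rw [p.stateAt_zero]
        exact hs
      · rw [← hw, p.stateAt_length]
        exact ht
    obtain ⟨hP1, hP2⟩ := key P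
    obtain ⟨hQ1, hQ2⟩ := key Q
    obtain ⟨s, t, w, p, hs, ht, hw⟩ := P
    obtain ⟨s', t', w', p', hs', ht', hw'⟩ := Q
    simp only at hP1 hP2 hQ1 hQ2
    obtain rfl : s = s' := (Set.mem_singleton_iff.1 hs).trans (Set.mem_singleton_iff.1 hs').symm
    obtain rfl : t = t' := (Set.mem_singleton_iff.1 ht).trans (Set.mem_singleton_iff.1 ht').symm
    obtain rfl : w = w' := List.ext_getElem (by rw [hw, hw']) fun i hi hi' => by rw [hP2, hQ2]
    obtain rfl : p = p' := p.ext_stateAt p' fun i hi => Fin.ext (by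
      rw [hP1 i (by omega), hQ1 i (by omega)])
    rfl

end Folded

end

theorem theorem4 (k n : ℕ) (hk : k ≤ 5) (hn : n = 2 ^ k - 1)
    (x : List (ZMod 2)) (hx : IsMSequence k x) :
    nondetAutomaticComplexity x = n / 2 + 1 := by
  obtain ⟨y, c, rfl, hspec⟩ := hx.exists_spec
  have hlen : (List.ofFn fun i : Fin (2 ^ k - 1) => y i).length = n := by
    rw [List.length_ofFn, hn]
  have hy : ∀ i (hi : i < (List.ofFn fun i : Fin (2 ^ k - 1) => y i).length),
      (List.ofFn fun i : Fin (2 ^ k - 1) => y i)[i] = y i := by simp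
  have hodd : n = 2 * (n / 2) + 1 := by
    obtain ⟨j, rfl⟩ := Nat.exists_eq_succ_of_ne_zero hspec.pos.ne'
    have := Nat.one_le_two_pow (n := j)
    rw [pow_succ] at hn
    omega
  have hmem : UniquelyAccepts (foldedNFA (n / 2) y) _ :=
    foldedNFA_uniquelyAccepts (hlen.trans hodd) hy
  refine le_antisymm (Nat.sInf_le ⟨_, hmem⟩) (le_csInf ⟨_, _, hmem⟩ ?_)
  · rintro q ⟨M, hM⟩
    obtain ⟨s, hs⟩ := hM.exists_uniqueWalk hy
    rw [hlen, hn] at hs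
    have h1 := hspec.le_card hk hs
    have h2 := Finset.card_le_univ ((Finset.range (2 ^ k - 1 + 1)).image s)
    rw [Fintype.card_fin] at h2
    omega
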